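/- Theorem 2. Satisfiability of finite $\mathrm{BSR}(\mathrm{BD})$ clause sets is decidable. Here there are two sorts: the base sort $\mathcal R$, always interpreted by $\mathbb R$, and a free sort $\mathcal S$, interpreted by an arbitrary nonempty set. There are variables of both sorts, free constant symbols of sort $\mathcal S$, and free predicate symbols $P:\xi_1\times\dots\times\xi_m$ ($m\ge 0$) with $\xi_i\in\{\mathcal R,\mathcal S\}$, interpreted by arbitrary sets $P^{\mathcal A}\subseteq\xi_1^{\mathcal A}\times\dots\times\xi_m^{\mathcal A}$. A $\mathrm{BSR}(\mathrm{BD})$ clause has the form $\Lambda\,\|\,\Gamma\to\Delta$ with finite multisets $\Lambda,\Gamma,\Delta$ of atoms such that (1) every atom in $\Lambda$ is a constraint $x\mathrel{\triangleleft}c$, $x\mathrel{\triangleleft}y$ or $x-y\mathrel{\triangleleft}c$, where $x,y$ are base-sort variables, $c\in\mathbb Q$ and ${\triangleleft}\in\{<,\le,=,\ne,\ge,>\}$; (2) whenever $\Lambda$ contains a constraint $x-y\mathrel{\triangleleft}c$, it also contains constraints $c_x\le x$, $x\le d_x$, $c_y\le y$, $y\le d_y$ with $c_x,d_x,c_y,d_y\in\mathbb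 Q$; (3) every atom in $\Gamma$ and $\Delta$ is either an equation $s\approx s'$ between free-sort variables or free-sort constant symbols, or a well-sorted atom $P(s_1,\dots,s_m)$ in which each $s_i$ is a base-sort variable, a free-sort variable or a free-sort constant symbol. An interpretation is a model of the clause if, for every assignment of real numbers to the base-sort variables and of domain elements to the free-sort variables under which all atoms in $\Lambda$ and $\Gamma$ hold, some atom in $\Delta$ holds; a clause set is satisfiable if some interpretation is a model of all its clauses. The claim is that there is an algorithm which, given a finite $\mathrm{BSR}(\mathrm{BD})$ clause set, decides whether it is satisfiable. -/

import Mathlib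

universe u

namespace BSRBD

/-! ### Codings

Decidability is Mathlib's `ComputablePred`, which needs a `Primcodable` instance on the type of inputs.
All syntactic objects are coded structurally; a rational number is coded by its numerator and
denominator in lowest terms. -/

theorem natAbs_eq_encode (z : ℤ) : (Encodable.encode z + 1) / 2 = z.natAbs := by
  rcases z with n | n
  · change (2 * n + 1) / 2 = n
    omega
  · change (2 * n + 1 + 1) / 2 = n + 1
    omega

theorem primrec_natAbs : Primrec Int.natAbs :=
  (Primrec.nat_div.comp (Primrec.succ.comp Primrec.encode) (Primrec.const 2)).of_eq
    fun z => natAbs_eq_encode z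

theorem primrecPred_coprime : PrimrecRel Nat.Coprime := by
  have hdvd : PrimrecRel fun d n : ℕ => n % d = 0 :=
    Primrec.eq.comp (Primrec.nat_mod.comp Primrec.snd Primrec.fst) (Primrec.const 0)
  have h1 : PrimrecRel fun (d : ℕ) (p : ℕ × ℕ) => ¬ (p.1 % d = 0 ∧ p.2 % d = 0 ∧ d ≠ 1) :=
    ((hdvd.comp Primrec.fst (Primrec.fst.comp Primrec.snd)).and
      ((hdvd.comp Primrec.fst (Primrec.snd.comp Primrec.snd)).and
        (Primrec.eq.comp Primrec.fst (Primrec.const 1)).not)).not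
  have h2 : PrimrecPred fun p : ℕ × ℕ => ∀ d ∈ List.range (p.1 + p.2 + 1),
      ¬ (p.1 % d = 0 ∧ p.2 % d = 0 ∧ d ≠ 1) :=
    h1.forall_mem_list.comp
      (Primrec.list_range.comp (Primrec.succ.comp (Primrec.nat_add.comp Primrec.fst Primrec.snd)))
      Primrec.id
  have h3 : PrimrecPred fun p : ℕ × ℕ => ¬ (p.1 = 0 ∧ p.2 = 0) :=
    ((Primrec.eq.comp Primrec.fst (Primrec.const 0)).and
      (Primrec.eq.comp Primrec.snd (Primrec.const 0))).not
  refine (h2.and h3).of_eq ?_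
  rintro ⟨a, b⟩
  constructor
  · rintro ⟨h, h0⟩
    by_contra hc
    refine h (Nat.gcd a b) ?_ ⟨Nat.mod_eq_zero_of_dvd (Nat.gcd_dvd_left a b),
      Nat.mod_eq_zero_of_dvd (Nat.gcd_dvd_right a b), hc⟩
    rw [List.mem_range]
    rcases Nat.eq_zero_or_pos a with ha | ha
    · have hb : 0 < b := Nat.pos_of_ne_zero fun hb => h0 ⟨ha, hb⟩
      have := Nat.gcd_le_right a hb
      omega
    · have := Nat.gcd_le_left b ha
      omega
  · intro hc
    refine ⟨?_, ?_⟩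
    · rintro d - ⟨h1, h2, h3⟩
      exact h3 (Nat.eq_one_of_dvd_coprimes hc (Nat.dvd_of_mod_eq_zero h1)
        (Nat.dvd_of_mod_eq_zero h2))
    · rintro ⟨rfl, rfl⟩
      simp at hc

/-- Pairs of a numerator and a denominator, in lowest terms. -/
abbrev IsReduced (p : ℤ × ℕ) : Prop := p.2 ≠ 0 ∧ p.1.natAbs.Coprime p.2

theorem primrecPred_isReduced : PrimrecPred IsReduced :=
  ((Primrec.eq.comp Primrec.snd (Primrec.const 0)).not).and
    (primrecPred_coprime.comp (primrec_natAbs.comp Primrec.fst) Primrec.snd)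

/-- A rational number is its reduced fraction. -/
def ratEquiv : ℚ ≃ {p : ℤ × ℕ // IsReduced p} where
  toFun q := ⟨(q.num, q.den), q.den_nz, q.reduced⟩
  invFun p := ⟨p.1.1, p.1.2, p.2.1, p.2.2⟩
  left_inv _ := rfl
  right_inv _ := rfl

instance ratPrimcodable : Primcodable ℚ :=
  letI : Primcodable {p : ℤ × ℕ // IsReduced p} := Primcodable.subtype primrecPred_isReduced
  Primcodable.ofEquiv _ ratEquiv

/-! ### Syntax

Base-sort variables, free-sort variables, free-sort constant symbols and names of predicate symbols
are indexed by natural numbers. -/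

/-- The relations `<`, `≤`, `=`, `≠`, `≥`, `>`. -/
inductive Rel
  | lt | le | eq | ne | ge | gt

/-- The linear arithmetic constraints `x ◁ c`, `x ◁ y` and `x - y ◁ c` with base-sort variables
`x`, `y` and a rational constant `c`. -/
inductive Constraint
  | varConst (x : ℕ) (r : Rel) (c : ℚ)
  | varVar (x : ℕ) (r : Rel) (y : ℕ)
  | diff (x y : ℕ) (r : Rel) (c : ℚ)

/-- The two sorts: the base sort (the reals) and the free sort. -/
inductive Srt
  | base | free

/-- A free predicate symbol `P : ξ₁ × ⋯ × ξₘ` consists of a name and its list of argument sorts, so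
that every symbol has a unique sort and there are infinitely many symbols of every sort. -/
structure PredSym where
  name : ℕ
  profile : List Srt

/-- Terms of the free sort: free-sort variables and free-sort constant symbols. -/
inductive FreeTerm
  | var (n : ℕ)
  | const (n : ℕ)

/-- Arguments of a free predicate symbol: base-sort variables and free-sort terms. -/
inductive Arg
  | base (x : ℕ)
  | free (t : FreeTerm)

/-- Atoms of the free part of a clause: equations `s ≈ t` and atoms `P(s₁, …, sₘ)`. -/
inductive FreeAtom
  | eqn (s t : FreeTerm)
  | pred (P : PredSym) (args : List Arg)

/-- A clause `Λ ‖ Γ → Δ`; the finite multisets `Λ`, `Γ`, `Δ` are presented as lists. -/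
structure Clause where
  constraints : List Constraint
  antecedent : List FreeAtom
  succedent : List FreeAtom

/-- A finite clause set, presented as a list. -/
abbrev ClauseSet := List Clause

def Arg.sort : Arg → Srt
  | .base _ => .base
  | .free _ => .free

/-- A non-equational atom is well sorted if its arguments match the sort of its predicate symbol. -/
def FreeAtom.WellSorted : FreeAtom → Prop
  | .eqn _ _ => True
  | .pred P args => args.map Arg.sort = P.profile

/-- BSR(BD) clauses: all atoms are well sorted, and both variables of a difference constraint have
rational lower and upper bounds among the constraints. -/
structure Clause.IsBSRBD (C : Clause) : Prop where
  wellSorted_antecedent : ∀ a ∈ C.antecedent, a.WellSorted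
  wellSorted_succedent : ∀ a ∈ C.succedent, a.WellSorted
  bounded : ∀ x y r c, Constraint.diff x y r c ∈ C.constraints →
    ∃ cx dx cy dy : ℚ,
      Constraint.varConst x .ge cx ∈ C.constraints ∧ Constraint.varConst x .le dx ∈ C.constraints ∧
      Constraint.varConst y .ge cy ∈ C.constraints ∧ Constraint.varConst y .le dy ∈ C.constraints

def ClauseSet.IsBSRBD (N : ClauseSet) : Prop := ∀ C ∈ N, C.IsBSRBD

/-! ### Semantics -/

def Rel.Holds : Rel → ℝ → ℝ → Prop
  | .lt, a, b => a < b
  | .le, a, b => a ≤ b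
  | .eq, a, b => a = b
  | .ne, a, b => a ≠ b
  | .ge, a, b => a ≥ b
  | .gt, a, b => a > b

def Constraint.Holds (β : ℕ → ℝ) : Constraint → Prop
  | .varConst x r c => r.Holds (β x) (c : ℝ)
  | .varVar x r y => r.Holds (β x) (β y)
  | .diff x y r c => r.Holds (β x - β y) (c : ℝ)

/-- The sort of an element of the disjoint union of `ℝ` and the free domain. -/
def valueSort {S : Type u} : ℝ ⊕ S → Srt
  | .inl _ => .base
  | .inr _ => .free

/-- Hierarchic interpretations: the base sort is `ℝ`, the free sort is any nonempty domain `S`, and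
`P : ξ₁ × ⋯ × ξₘ` is interpreted by a set of tuples `(v₁, …, vₘ)` with `vᵢ` of sort `ξᵢ`. -/
structure Interpretation where
  S : Type u
  nonempty : Nonempty S
  const : ℕ → S
  rel : PredSym → Set (List (ℝ ⊕ S))
  rel_sorted : ∀ P, ∀ v ∈ rel P, v.map valueSort = P.profile

namespace Interpretation

variable (A : Interpretation.{u})

def evalFree (βS : ℕ → A.S) : FreeTerm → A.S
  | .var n => βS n
  | .const n => A.const n

def evalArg (βR : ℕ → ℝ) (βS : ℕ → A.S) : Arg → ℝ ⊕ A.S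
  | .base x => .inl (βR x)
  | .free t => .inr (A.evalFree βS t)

def HoldsAtom (βR : ℕ → ℝ) (βS : ℕ → A.S) : FreeAtom → Prop
  | .eqn s t => A.evalFree βS s = A.evalFree βS t
  | .pred P args => args.map (A.evalArg βR βS) ∈ A.rel P

/-- `A, β ⊨ C`: if all atoms of `Λ` and `Γ` hold, then some atom of `Δ` holds. -/
def HoldsClause (βR : ℕ → ℝ) (βS : ℕ → A.S) (C : Clause) : Prop :=
  (∀ a ∈ C.constraints, a.Holds βR) → (∀ a ∈ C.antecedent, A.HoldsAtom βR βS a) →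
    ∃ a ∈ C.succedent, A.HoldsAtom βR βS a

/-- `A ⊨ C`: the variables of a clause are universally quantified. -/
def IsModelOfClause (C : Clause) : Prop :=
  ∀ (βR : ℕ → ℝ) (βS : ℕ → A.S), A.HoldsClause βR βS C

def IsModel (N : ClauseSet) : Prop := ∀ C ∈ N, A.IsModelOfClause C

end Interpretation

/-- A clause set is satisfiable if it has a model (with a free domain in `Type u`). -/
def ClauseSet.Satisfiable (N : ClauseSet) : Prop := ∃ A : Interpretation.{u}, A.IsModel N

/-! ### Structural codings of the syntax -/

def Rel.equiv : Rel ≃ Fin 6 where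
  toFun
    | .lt => 0
    | .le => 1
    | .eq => 2
    | .ne => 3
    | .ge => 4
    | .gt => 5
  invFun
    | 0 => .lt
    | 1 => .le
    | 2 => .eq
    | 3 => .ne
    | 4 => .ge
    | 5 => .gt
  left_inv r := by cases r <;> rfl
  right_inv i := by fin_cases i <;> rfl

instance : Primcodable Rel := Primcodable.ofEquiv _ Rel.equiv

def Constraint.equiv : Constraint ≃ (ℕ × Rel × ℚ) ⊕ (ℕ × Rel × ℕ) ⊕ (ℕ × ℕ × Rel × ℚ) where
  toFun
    | .varConst x r c => .inl (x, r, c)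
    | .varVar x r y => .inr (.inl (x, r, y))
    | .diff x y r c => .inr (.inr (x, y, r, c))
  invFun
    | .inl (x, r, c) => .varConst x r c
    | .inr (.inl (x, r, y)) => .varVar x r y
    | .inr (.inr (x, y, r, c)) => .diff x y r c
  left_inv a := by cases a <;> rfl
  right_inv a := by rcases a with _ | _ | _ <;> rfl

instance : Primcodable Constraint := Primcodable.ofEquiv _ Constraint.equiv

def Srt.equiv : Srt ≃ Bool where
  toFun
    | .base => false
    | .free => true
  invFun
    | false => .base
    | true => .free
  left_inv a := by cases a <;> rfl
  right_inv a := by cases a <;> rfl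

instance : Primcodable Srt := Primcodable.ofEquiv _ Srt.equiv

def PredSym.equiv : PredSym ≃ ℕ × List Srt where
  toFun P := (P.name, P.profile)
  invFun p := ⟨p.1, p.2⟩
  left_inv _ := rfl
  right_inv _ := rfl

instance : Primcodable PredSym := Primcodable.ofEquiv _ PredSym.equiv

def FreeTerm.equiv : FreeTerm ≃ ℕ ⊕ ℕ where
  toFun
    | .var n => .inl n
    | .const n => .inr n
  invFun
    | .inl n => .var n
    | .inr n => .const n
  left_inv a := by cases a <;> rfl
  right_inv a := by cases a <;> rfl

instance : Primcodable FreeTerm := Primcodable.ofEquiv _ FreeTerm.equiv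

def Arg.equiv : Arg ≃ ℕ ⊕ FreeTerm where
  toFun
    | .base n => .inl n
    | .free t => .inr t
  invFun
    | .inl n => .base n
    | .inr t => .free t
  left_inv a := by cases a <;> rfl
  right_inv a := by cases a <;> rfl

instance : Primcodable Arg := Primcodable.ofEquiv _ Arg.equiv

def FreeAtom.equiv : FreeAtom ≃ (FreeTerm × FreeTerm) ⊕ (PredSym × List Arg) where
  toFun
    | .eqn s t => .inl (s, t)
    | .pred P args => .inr (P, args)
  invFun
    | .inl (s, t) => .eqn s t
    | .inr (P, args) => .pred P args
  left_inv a := by cases a <;> rfl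
  right_inv a := by rcases a with _ | _ <;> rfl

instance : Primcodable FreeAtom := Primcodable.ofEquiv _ FreeAtom.equiv

def Clause.equiv : Clause ≃ List Constraint × List FreeAtom × List FreeAtom where
  toFun C := (C.constraints, C.antecedent, C.succedent)
  invFun p := ⟨p.1, p.2.1, p.2.2⟩
  left_inv _ := rfl
  right_inv _ := rfl

instance : Primcodable Clause := Primcodable.ofEquiv _ Clause.equiv

end BSRBD

namespace BSRBD

/-! Let `E` be one more than the code of the clause set, so that `E` exceeds every variable index
and every numerator and denominator that occurs. After scaling by `E!` all constants are integers. A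
constraint therefore sees only the integer parts of the scaled values and the order of their
fractional parts, with 0 included in that order, much like the regions of timed automata
(`Constraint.check_iff_holds`). A strictly increasing map that fixes `[-E, E]` presses the real line
into `(-(E+1), E+1)`. It preserves comparisons with constants and between variables, and also
differences, because the variables of a difference are confined to `[-E, E]` by their bounds
(`holds_compress`). So only finitely many integer parts matter, and since fewer than `E + 1`
variables are relevant, 0 together with `E` positive fractional values realizes every order. This
gives a finite grid of points.

Predicates may still separate tuples from the same region. Given a model, a finite Ramsey argument
(`exists_homogeneous`) supplies `E` fractional values at which the truth of each of the finitely
many ground atoms depends only on its similarity class (`exists_trueAt_iff_of_sim`). As clauses are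
universal, they survive restriction to these points and to the elements named by constants with
index below `E`, which gives a finite model (`finitelySatisfiable_of_satisfiable`). Conversely, a
finite table of atoms up to similarity is pulled back to all reals by reading off the region of each
tuple (`satisfiable_of_finitelySatisfiable`). Satisfiability thus amounts to a bounded search, and
the search is primitive recursive. -/

open Encodable

/-! ### A finite decision procedure -/

/-- The lists of length at most `n` with entries in `L`. -/
def listsUpTo {α : Type*} (L : List α) : ℕ → List (List α)
  | 0 => [[]]
  | n + 1 => [] :: L.flatMap fun x => (listsUpTo L n).map (x :: ·)

theorem mem_listsUpTo {α : Type*} {L : List α} {n : ℕ} {l : List α} :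
    l ∈ listsUpTo L n ↔ l.length ≤ n ∧ ∀ x ∈ l, x ∈ L := by
  induction n generalizing l with
  | zero => cases l <;> simp [listsUpTo]
  | succ n ih =>
    cases l with
    | nil => simp [listsUpTo]
    | cons a l =>
      simp only [listsUpTo, List.mem_cons, List.mem_flatMap, List.mem_map, ih]
      constructor
      · rintro (h | ⟨x, hx, m, hm, h⟩)
        · cases h
        · cases h
          exact ⟨by simpa using hm.1, by simpa using ⟨hx, hm.2⟩⟩
      · rintro ⟨h1, h2⟩
        simp at h1 h2
        exact .inr ⟨a, h2.1, l, ⟨h1, h2.2⟩, rfl⟩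

/-- A ground argument: its label is an integer part (base sort) or an element of the free sort, and
its second component stands for the fractional part. -/
abbrev GVal (α : Type*) := (ℕ ⊕ ℕ) × α

/-- Two lists of ground arguments have the same labels and the same order of fractional parts.
Entries beyond the end of the lists count as `0`. -/
def Sim {α β : Type*} [Zero α] [LT α] [Zero β] [LT β] (a : List (GVal α)) (b : List (GVal β)) :
    Prop :=
  a.length = b.length ∧ ∀ i, (a.getD i (.inl 0, 0)).1 = (b.getD i (.inl 0, 0)).1 ∧
    ∀ j, (a.getD i (.inl 0, 0)).2 < (a.getD j (.inl 0, 0)).2 ↔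
      (b.getD i (.inl 0, 0)).2 < (b.getD j (.inl 0, 0)).2

/-- The common denominator of all points. -/
def denom (E : ℕ) : ℕ := E.factorial * (E + 1)

/-- The interval `[-(E+1), E+1)` consists of `2(E+1)·E!` cells of length `1/E!`, and each cell
carries `E + 1` grid points. -/
def numPoints (E : ℕ) : ℕ := 2 * (E + 1) * denom E

/-- The real number that the point `n` stands for. -/
noncomputable def pos (E n : ℕ) : ℝ := n / denom E - (E + 1)

/-- The quotient is the cell, that is, the integer part after scaling by `E!`. The remainder is only
a rank among fractional parts, with 0 for the left end of the cell. -/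
def pointVal (E n : ℕ) : GVal ℕ := (.inl (n / (E + 1)), n % (E + 1))

/-- Denominators are cleared and negative terms moved across, so that only natural numbers are
compared and the test is visibly primitive recursive. -/
def Constraint.Check (E : ℕ) (b : List ℕ) : Constraint → Prop
  | .varConst x r c => r.Holds ((b.getD x 0 * c.den + (-c.num).toNat * denom E : ℕ) : ℝ)
      ((c.num.toNat * denom E + (E + 1) * denom E * c.den : ℕ) : ℝ)
  | .varVar x r y => r.Holds (b.getD x 0 : ℝ) (b.getD y 0 : ℝ)
  | .diff x y r c => r.Holds ((b.getD x 0 * c.den + (-c.num).toNat * denom E : ℕ) : ℝ)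
      ((c.num.toNat * denom E + b.getD y 0 * c.den : ℕ) : ℝ)

/-- The list `ρ` interprets the constants. The free domain is `0 :: ρ`, which is nonempty and
contains the default value 0. -/
def FreeTerm.value (ρ s : List ℕ) : FreeTerm → ℕ
  | .var n => s.getD n 0
  | .const n => ρ.getD n 0

def Arg.value (E : ℕ) (ρ b s : List ℕ) : Arg → GVal ℕ
  | .base x => pointVal E (b.getD x 0)
  | .free t => (.inr (t.value ρ s), 0)

/-- Testing for similarity to a member of `V`, rather than for membership, makes truth a property of
the similarity class. -/
def FreeAtom.Check (E : ℕ) (ρ : List ℕ) (V : List (ℕ × List (GVal ℕ))) (b s : List ℕ) :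
    FreeAtom → Prop
  | .eqn t t' => t.value ρ s = t'.value ρ s
  | .pred P args => ∃ v ∈ V, v.1 = encode P ∧ Sim v.2 (args.map (Arg.value E ρ b s))

def Clause.Check (E : ℕ) (ρ : List ℕ) (V : List (ℕ × List (GVal ℕ))) (b s : List ℕ)
    (C : Clause) : Prop :=
  (∀ a ∈ C.constraints, a.Check E b) → (∀ a ∈ C.antecedent, a.Check E ρ V b s) →
    ∃ a ∈ C.succedent, a.Check E ρ V b s

def groundValues (E : ℕ) : List (GVal ℕ) :=
  (List.range (numPoints E)).map (pointVal E) ++ (List.range E).map fun e => (.inr e, 0)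

def groundAtoms (E : ℕ) : List (ℕ × List (GVal ℕ)) :=
  (List.range E).flatMap fun c => (listsUpTo (groundValues E) E).map fun a => (c, a)

/-- `N` has a model over the points of level `E` and the numbers below `E`, up to `Sim`. -/
def FinitelySatisfiable (E : ℕ) (N : ClauseSet) : Prop :=
  ∃ ρ ∈ listsUpTo (List.range E) E, ∃ V ∈ listsUpTo (groundAtoms E) (groundAtoms E).length,
    ∀ C ∈ N, ∀ b ∈ listsUpTo (List.range (numPoints E)) E, ∀ s ∈ listsUpTo (0 :: ρ) E,
      C.Check E ρ V b s

/-! ### The procedure is primitive recursive -/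

section Primrec

variable {α β γ δ : Type*} [Primcodable α] [Primcodable β] [Primcodable γ] [Primcodable δ]

/-- Case distinction on syntax: each syntactic type is coded through an equivalence with a sum of
simpler types. -/
theorem primrecPred_sumElim {f : γ → α ⊕ β} {p : γ → α → Prop} {q : γ → β → Prop}
    (hf : Primrec f) (hp : PrimrecRel p) (hq : PrimrecRel q) :
    PrimrecPred fun x => Sum.elim (p x) (q x) (f x) := by
  classical
  refine Primrec.primrecPred ((Primrec.sumCasesOn hf hp.decide hq.decide).of_eq fun x => ?_)
  cases f x <;> rfl

theorem primrecPred_forall_mem {f : γ → List α} {p : γ → α → Prop} (hf : Primrec f)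
    (hp : PrimrecRel p) : PrimrecPred fun x => ∀ a ∈ f x, p x a :=
  (hp.swap.forall_mem_list.comp hf Primrec.id)

theorem primrecPred_exists_mem {f : γ → List α} {p : γ → α → Prop} (hf : Primrec f)
    (hp : PrimrecRel p) : PrimrecPred fun x => ∃ a ∈ f x, p x a :=
  (hp.swap.exists_mem_list.comp hf Primrec.id)

theorem primrecPred_forall_lt {f : γ → ℕ} {p : γ → ℕ → Prop} (hf : Primrec f)
    (hp : PrimrecRel p) : PrimrecPred fun x => ∀ a < f x, p x a :=
  (primrecPred_forall_mem (Primrec.list_range.comp hf) hp).of_eq fun _ => by simp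

theorem primrecPred_imp {p q : γ → Prop} (hp : PrimrecPred p) (hq : PrimrecPred q) :
    PrimrecPred fun x => p x → q x :=
  (hp.not.or hq).of_eq fun _ => imp_iff_not_or.symm

theorem primrecPred_iff {p q : γ → Prop} (hp : PrimrecPred p) (hq : PrimrecPred q) :
    PrimrecPred fun x => p x ↔ q x :=
  ((primrecPred_imp hp hq).and (primrecPred_imp hq hp)).of_eq fun _ => iff_iff_implies_and_implies.symm

theorem primrec_getD {f : γ → List α} {g : γ → ℕ} (d : α) (hf : Primrec f) (hg : Primrec g) :
    Primrec fun x => (f x).getD (g x) d :=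
  (Primrec.list_getD d).comp hf hg

theorem primrec_listsUpTo {f : γ → List α} {g : γ → ℕ} (hf : Primrec f) (hg : Primrec g) :
    Primrec fun x => listsUpTo (f x) (g x) := by
  have hstep : Primrec₂ fun (x : γ) (p : ℕ × List (List α)) =>
      [] :: (f x).flatMap fun y => p.2.map (y :: ·) := by
    refine Primrec.list_cons.comp (Primrec.const []) (Primrec.list_flatMap (hf.comp .fst) ?_)
    refine Primrec.list_map (Primrec.snd.comp (Primrec.snd.comp .fst)) ?_
    exact Primrec.list_cons.comp (Primrec.snd.comp .fst) .snd
  refine (Primrec.nat_rec' hg (Primrec.const [[]]) hstep).of_eq fun x => ?_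
  induction g x with
  | zero => rfl
  | succ n ih => simp only [ih, listsUpTo]

theorem primrec_factorial : Primrec Nat.factorial := by
  have h : Primrec₂ fun (_ : ℕ) (p : ℕ × ℕ) => (p.1 + 1) * p.2 :=
    Primrec.nat_mul.comp (Primrec.succ.comp (Primrec.fst.comp .snd)) (Primrec.snd.comp .snd)
  refine (Primrec.nat_rec' Primrec.id (Primrec.const 1) h).of_eq fun n => ?_
  induction n with
  | zero => rfl
  | succ n ih => simp only [id] at ih ⊢; rw [ih, Nat.factorial_succ]

theorem primrec_denom : Primrec denom :=
  Primrec.nat_mul.comp primrec_factorial Primrec.succ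

theorem primrec_numPoints : Primrec numPoints :=
  Primrec.nat_mul.comp (Primrec.nat_mul.comp (Primrec.const 2) Primrec.succ) primrec_denom

theorem primrec_pointVal : Primrec₂ pointVal :=
  (Primrec.sumInl.comp (Primrec.nat_div.comp .snd (Primrec.succ.comp .fst))).pair
    (Primrec.nat_mod.comp .snd (Primrec.succ.comp .fst))

theorem primrec_groundValues : Primrec groundValues := by
  refine Primrec.list_append.comp
    (Primrec.list_map (Primrec.list_range.comp primrec_numPoints) primrec_pointVal)
    (Primrec.list_map Primrec.list_range ?_)
  exact (Primrec.sumInr.comp .snd).pair (Primrec.const 0)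

theorem primrec_groundAtoms : Primrec groundAtoms := by
  refine Primrec.list_flatMap Primrec.list_range ?_
  refine Primrec.list_map ((primrec_listsUpTo primrec_groundValues Primrec.id).comp .fst) ?_
  exact (Primrec.snd.comp .fst).pair .snd

theorem primrec_toNat : Primrec Int.toNat := by
  refine (Primrec.ite (c := fun z : ℤ => encode z % 2 = 0) (f := Int.natAbs) (g := fun _ => 0)
    (Primrec.eq.comp (Primrec.nat_mod.comp Primrec.encode (Primrec.const 2)) (Primrec.const 0))
    primrec_natAbs (Primrec.const 0)).of_eq fun z => ?_
  rcases z with n | n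
  · have : encode (Int.ofNat n) = 2 * n := rfl
    rw [if_pos (by omega)]
    rfl
  · have : encode (Int.negSucc n) = 2 * n + 1 := rfl
    rw [if_neg (by omega)]
    rfl

theorem primrec_neg_toNat : Primrec fun z : ℤ => (-z).toNat := by
  -- The negative part of an integer is its absolute value minus its positive part.
  refine (Primrec.nat_sub.comp primrec_natAbs primrec_toNat).of_eq fun z => ?_
  omega

theorem primrec_num : Primrec Rat.num := by
  let : Primcodable {p : ℤ × ℕ // IsReduced p} := Primcodable.subtype primrecPred_isReduced
  have h : Primrec ratEquiv := Primrec.of_equiv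
  exact Primrec.fst.comp (Primrec.subtype_val.comp h)

theorem primrec_den : Primrec Rat.den := by
  let : Primcodable {p : ℤ × ℕ // IsReduced p} := Primcodable.subtype primrecPred_isReduced
  have h : Primrec ratEquiv := Primrec.of_equiv
  exact Primrec.snd.comp (Primrec.subtype_val.comp h)

theorem primrecPred_holds {r : γ → Rel} {m n : γ → ℕ} (hr : Primrec r) (hm : Primrec m)
    (hn : Primrec n) : PrimrecPred fun x => (r x).Holds (m x : ℝ) (n x : ℝ) := by
  have e (s : Rel) : PrimrecPred fun x => r x = s := Primrec.eq.comp hr (Primrec.const s)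
  have hlt := Primrec.nat_lt.comp hm hn
  have hgt := Primrec.nat_lt.comp hn hm
  refine (((e .lt).and hlt).or <| ((e .le).and hgt.not).or <|
    ((e .eq).and (hlt.or hgt).not).or <| ((e .ne).and (hlt.or hgt)).or <|
    ((e .ge).and hlt.not).or ((e .gt).and hgt)).of_eq fun x => ?_
  cases r x <;> simp [Rel.Holds]

theorem primrec_scaledPoint {E x : γ → ℕ} {b : γ → List ℕ} {c : γ → ℚ} (hE : Primrec E)
    (hb : Primrec b) (hx : Primrec x) (hc : Primrec c) : Primrec fun z =>
      (b z).getD (x z) 0 * (c z).den + (-(c z).num).toNat * denom (E z) :=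
  Primrec.nat_add.comp (Primrec.nat_mul.comp (primrec_getD 0 hb hx) (primrec_den.comp hc))
    (Primrec.nat_mul.comp (primrec_neg_toNat.comp (primrec_num.comp hc)) (primrec_denom.comp hE))

theorem primrec_scaledNum {E : γ → ℕ} {c : γ → ℚ} (hE : Primrec E) (hc : Primrec c) :
    Primrec fun z => (c z).num.toNat * denom (E z) :=
  Primrec.nat_mul.comp (primrec_toNat.comp (primrec_num.comp hc)) (primrec_denom.comp hE)

theorem primrecPred_constraintCheck {E : γ → ℕ} {b : γ → List ℕ} {a : γ → Constraint}
    (hE : Primrec E) (hb : Primrec b) (ha : Primrec a) :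
    PrimrecPred fun x => (a x).Check (E x) (b x) := by
  have h : Primrec fun x => Constraint.equiv (a x) := Primrec.of_equiv.comp ha
  have hconst : PrimrecRel fun (z : γ) (p : ℕ × Rel × ℚ) =>
      (Constraint.varConst p.1 p.2.1 p.2.2).Check (E z) (b z) :=
    have hE := hE.comp (Primrec.fst (β := ℕ × Rel × ℚ))
    have hc := Primrec.snd.comp (Primrec.snd.comp (Primrec.snd (α := γ) (β := ℕ × Rel × ℚ)))
    primrecPred_holds (Primrec.fst.comp (Primrec.snd.comp .snd))
      (primrec_scaledPoint hE (hb.comp .fst) (Primrec.fst.comp .snd) hc)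
      (Primrec.nat_add.comp (primrec_scaledNum hE hc) (Primrec.nat_mul.comp
        (Primrec.nat_mul.comp (Primrec.succ.comp hE) (primrec_denom.comp hE))
        (primrec_den.comp hc)))
  have hvar : PrimrecRel fun (z : γ) (p : ℕ × Rel × ℕ) =>
      (Constraint.varVar p.1 p.2.1 p.2.2).Check (E z) (b z) :=
    primrecPred_holds (Primrec.fst.comp (Primrec.snd.comp .snd))
      (primrec_getD 0 (hb.comp .fst) (Primrec.fst.comp .snd))
      (primrec_getD 0 (hb.comp .fst) (Primrec.snd.comp (Primrec.snd.comp .snd)))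
  have hdiff : PrimrecRel fun (z : γ) (p : ℕ × ℕ × Rel × ℚ) =>
      (Constraint.diff p.1 p.2.1 p.2.2.1 p.2.2.2).Check (E z) (b z) :=
    have hE := hE.comp (Primrec.fst (β := ℕ × ℕ × Rel × ℚ))
    have hc := Primrec.snd.comp (Primrec.snd.comp (Primrec.snd.comp
      (Primrec.snd (α := γ) (β := ℕ × ℕ × Rel × ℚ))))
    primrecPred_holds (Primrec.fst.comp (Primrec.snd.comp (Primrec.snd.comp .snd)))
      (primrec_scaledPoint hE (hb.comp .fst) (Primrec.fst.comp .snd) hc)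
      (Primrec.nat_add.comp (primrec_scaledNum hE hc) (Primrec.nat_mul.comp
        (primrec_getD 0 (hb.comp .fst) (Primrec.fst.comp (Primrec.snd.comp .snd)))
        (primrec_den.comp hc)))
  have hrest : PrimrecRel fun (z : γ) (p : (ℕ × Rel × ℕ) ⊕ (ℕ × ℕ × Rel × ℚ)) =>
      Sum.elim (fun p => (Constraint.varVar p.1 p.2.1 p.2.2).Check (E z) (b z))
        (fun p => (Constraint.diff p.1 p.2.1 p.2.2.1 p.2.2.2).Check (E z) (b z)) p :=
    primrecPred_sumElim .snd
      (PrimrecRel.comp hvar (Primrec.fst.comp .fst) .snd)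
      (PrimrecRel.comp hdiff (Primrec.fst.comp .fst) .snd)
  refine (primrecPred_sumElim h hconst hrest).of_eq fun x => ?_
  cases a x <;> rfl

theorem primrec_freeTermValue {ρ s : γ → List ℕ} {t : γ → FreeTerm} (hρ : Primrec ρ)
    (hs : Primrec s) (ht : Primrec t) : Primrec fun x => (t x).value (ρ x) (s x) := by
  have h : Primrec fun x => FreeTerm.equiv (t x) := Primrec.of_equiv.comp ht
  refine (Primrec.sumCasesOn h (primrec_getD 0 (hs.comp .fst) .snd).to₂
    (primrec_getD 0 (hρ.comp .fst) .snd).to₂).of_eq fun x => ?_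
  cases t x <;> rfl

theorem primrec_argValue {E : γ → ℕ} {ρ b s : γ → List ℕ} {a : γ → Arg} (hE : Primrec E)
    (hρ : Primrec ρ) (hb : Primrec b) (hs : Primrec s) (ha : Primrec a) :
    Primrec fun x => (a x).value (E x) (ρ x) (b x) (s x) := by
  have h : Primrec fun x => Arg.equiv (a x) := Primrec.of_equiv.comp ha
  refine (Primrec.sumCasesOn h
    (primrec_pointVal.comp (hE.comp .fst) (primrec_getD 0 (hb.comp .fst) .snd)).to₂
    ((Primrec.sumInr.comp (primrec_freeTermValue (hρ.comp .fst) (hs.comp .fst) .snd)).pair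
      (Primrec.const 0)).to₂).of_eq fun x => ?_
  cases a x <;> rfl

/-- All indices past the end read the same default entry, so the single index `a.length` represents
them and the quantifiers become bounded. -/
theorem sim_iff_forall_le {a b : List (GVal ℕ)} : Sim a b ↔
    a.length = b.length ∧ ∀ i < a.length + 1,
      (a.getD i (.inl 0, 0)).1 = (b.getD i (.inl 0, 0)).1 ∧ ∀ j < a.length + 1,
        ((a.getD i (.inl 0, 0)).2 < (a.getD j (.inl 0, 0)).2 ↔
          (b.getD i (.inl 0, 0)).2 < (b.getD j (.inl 0, 0)).2) := by
  refine and_congr_right fun hl => ⟨fun h i _ => ⟨(h i).1, fun j _ => (h i).2 j⟩, fun h => ?_⟩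
  have key (i : ℕ) : ∃ i' < a.length + 1, a.getD i (.inl 0, 0) = a.getD i' (.inl 0, 0) ∧
      b.getD i (.inl 0, 0) = b.getD i' (.inl 0, 0) := by
    rcases lt_or_ge i a.length with hi | hi
    · exact ⟨i, by omega, rfl, rfl⟩
    · refine ⟨a.length, by omega, ?_, ?_⟩ <;>
        rw [List.getD_eq_default _ _ (by omega), List.getD_eq_default _ _ (by omega)]
  intro i
  obtain ⟨i', hi, h1, h2⟩ := key i
  rw [h1, h2]
  refine ⟨(h i' hi).1, fun j => ?_⟩
  obtain ⟨j', hj, h3, h4⟩ := key j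
  rw [h3, h4]
  exact (h i' hi).2 j' hj

theorem primrecPred_sim {f g : γ → List (GVal ℕ)} (hf : Primrec f) (hg : Primrec g) :
    PrimrecPred fun x => Sim (f x) (g x) := by
  have hlen := Primrec.succ.comp (Primrec.list_length.comp hf)
  have hlt {f : γ → List (GVal ℕ)} (hf : Primrec f) : PrimrecPred fun p : (γ × ℕ) × ℕ =>
      ((f p.1.1).getD p.1.2 (.inl 0, 0)).2 < ((f p.1.1).getD p.2 (.inl 0, 0)).2 :=
    have hf := hf.comp (Primrec.fst.comp (Primrec.fst (α := γ × ℕ) (β := ℕ)))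
    PrimrecRel.comp Primrec.nat_lt
      (Primrec.snd.comp (primrec_getD _ hf (Primrec.snd.comp .fst)))
      (Primrec.snd.comp (primrec_getD _ hf .snd))
  have hj : PrimrecRel fun (x : γ) (i : ℕ) => ∀ j < (f x).length + 1,
      (((f x).getD i (.inl 0, 0)).2 < ((f x).getD j (.inl 0, 0)).2 ↔
        ((g x).getD i (.inl 0, 0)).2 < ((g x).getD j (.inl 0, 0)).2) :=
    primrecPred_forall_lt (hlen.comp .fst) (primrecPred_iff (hlt hf) (hlt hg)).primrecRel
  have hl : PrimrecRel fun (x : γ) (i : ℕ) =>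
      ((f x).getD i (.inl 0, 0)).1 = ((g x).getD i (.inl 0, 0)).1 :=
    PrimrecRel.comp Primrec.eq
      (Primrec.fst.comp (primrec_getD (.inl 0, 0) (hf.comp .fst) .snd))
      (Primrec.fst.comp (primrec_getD (.inl 0, 0) (hg.comp .fst) .snd))
  refine ((PrimrecRel.comp Primrec.eq (Primrec.list_length.comp hf)
    (Primrec.list_length.comp hg)).and (primrecPred_forall_lt hlen (PrimrecPred.and hl hj).primrecRel)).of_eq
      fun x => sim_iff_forall_le.symm

theorem primrecPred_atomCheck {E : γ → ℕ} {ρ b s : γ → List ℕ}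
    {V : γ → List (ℕ × List (GVal ℕ))} {a : γ → FreeAtom} (hE : Primrec E) (hρ : Primrec ρ)
    (hV : Primrec V) (hb : Primrec b) (hs : Primrec s) (ha : Primrec a) :
    PrimrecPred fun x => (a x).Check (E x) (ρ x) (V x) (b x) (s x) := by
  have h : Primrec fun x => FreeAtom.equiv (a x) := Primrec.of_equiv.comp ha
  have heqn : PrimrecRel fun (x : γ) (p : FreeTerm × FreeTerm) =>
      (FreeAtom.eqn p.1 p.2).Check (E x) (ρ x) (V x) (b x) (s x) :=
    PrimrecRel.comp Primrec.eq
      (primrec_freeTermValue (hρ.comp .fst) (hs.comp .fst) (Primrec.fst.comp .snd))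
      (primrec_freeTermValue (hρ.comp .fst) (hs.comp .fst) (Primrec.snd.comp .snd))
  have hargs : Primrec fun (x : γ × List Arg) =>
      x.2.map (Arg.value (E x.1) (ρ x.1) (b x.1) (s x.1)) :=
    have h1 := Primrec.fst.comp (Primrec.fst (α := γ × List Arg) (β := Arg))
    Primrec.list_map .snd
      (primrec_argValue (hE.comp h1) (hρ.comp h1) (hb.comp h1) (hs.comp h1) .snd).to₂
  have hpred : PrimrecRel fun (x : γ) (p : PredSym × List Arg) =>
      (FreeAtom.pred p.1 p.2).Check (E x) (ρ x) (V x) (b x) (s x) := by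
    refine primrecPred_exists_mem (hV.comp .fst) (PrimrecPred.and ?_ ?_)
    · exact PrimrecRel.comp Primrec.eq (Primrec.fst.comp .snd)
        (Primrec.encode.comp (Primrec.fst.comp (Primrec.snd.comp .fst)))
    · exact primrecPred_sim (Primrec.snd.comp .snd)
        (hargs.comp ((Primrec.fst.comp .fst).pair (Primrec.snd.comp (Primrec.snd.comp .fst))))
  refine (primrecPred_sumElim h heqn hpred).of_eq fun x => ?_
  cases a x <;> rfl

theorem primrec_constraints : Primrec Clause.constraints :=
  Primrec.fst.comp (Primrec.of_equiv (e := Clause.equiv))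

theorem primrec_antecedent : Primrec Clause.antecedent :=
  Primrec.fst.comp (Primrec.snd.comp (Primrec.of_equiv (e := Clause.equiv)))

theorem primrec_succedent : Primrec Clause.succedent :=
  Primrec.snd.comp (Primrec.snd.comp (Primrec.of_equiv (e := Clause.equiv)))

theorem primrecPred_clauseCheck {E : γ → ℕ} {ρ b s : γ → List ℕ}
    {V : γ → List (ℕ × List (GVal ℕ))} {C : γ → Clause} (hE : Primrec E) (hρ : Primrec ρ)
    (hV : Primrec V) (hb : Primrec b) (hs : Primrec s) (hC : Primrec C) :
    PrimrecPred fun x => (C x).Check (E x) (ρ x) (V x) (b x) (s x) :=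
  have hatom := (primrecPred_atomCheck (hE.comp .fst) (hρ.comp .fst) (hV.comp .fst) (hb.comp .fst)
    (hs.comp .fst) (Primrec.snd (α := γ) (β := FreeAtom))).primrecRel
  primrecPred_imp (primrecPred_forall_mem (primrec_constraints.comp hC)
      (primrecPred_constraintCheck (hE.comp .fst) (hb.comp .fst) .snd).primrecRel)
    (primrecPred_imp (primrecPred_forall_mem (primrec_antecedent.comp hC) hatom)
      (primrecPred_exists_mem (primrec_succedent.comp hC) hatom))

/-- Every quantifier ranges over a list computed from `E` and `N`. -/
theorem primrecPred_finitelySatisfiable {E : γ → ℕ} {N : γ → ClauseSet} (hE : Primrec E)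
    (hN : Primrec N) : PrimrecPred fun x => FinitelySatisfiable (E x) (N x) := by
  have hA := primrec_groundAtoms.comp hE
  refine primrecPred_exists_mem (primrec_listsUpTo (Primrec.list_range.comp hE) hE) ?_
  refine primrecPred_exists_mem
    (primrec_listsUpTo (hA.comp .fst) (Primrec.list_length.comp (hA.comp .fst))) ?_
  refine primrecPred_forall_mem (hN.comp (Primrec.fst.comp .fst)) ?_
  refine primrecPred_forall_mem (primrec_listsUpTo (Primrec.list_range.comp
    (primrec_numPoints.comp (hE.comp (Primrec.fst.comp (Primrec.fst.comp .fst)))))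
      (hE.comp (Primrec.fst.comp (Primrec.fst.comp .fst)))) ?_
  refine primrecPred_forall_mem (primrec_listsUpTo (Primrec.list_cons.comp (.const 0)
    (Primrec.snd.comp (Primrec.fst.comp (Primrec.fst.comp .fst))))
      (hE.comp (Primrec.fst.comp (Primrec.fst.comp (Primrec.fst.comp .fst))))) ?_
  have h1 := Primrec.fst (α := (((γ × List ℕ) × List (ℕ × List (GVal ℕ))) × Clause) × List ℕ)
    (β := List ℕ)
  exact primrecPred_clauseCheck
    (hE.comp (Primrec.fst.comp (Primrec.fst.comp (Primrec.fst.comp (Primrec.fst.comp h1)))))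
    (Primrec.snd.comp (Primrec.fst.comp (Primrec.fst.comp (Primrec.fst.comp h1))))
    (Primrec.snd.comp (Primrec.fst.comp (Primrec.fst.comp h1)))
    (Primrec.snd.comp h1) .snd (Primrec.snd.comp (Primrec.fst.comp h1))

/-! ### Being a BSR(BD) clause set is primitive recursive -/

theorem primrecPred_wellSorted : PrimrecPred FreeAtom.WellSorted := by
  have hsort : Primrec Arg.sort := by
    refine (Primrec.sumCasesOn (Primrec.of_equiv (e := Arg.equiv)) (Primrec.const Srt.base).to₂
      (Primrec.const Srt.free).to₂).of_eq fun a => ?_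
    cases a <;> rfl
  have hprofile : Primrec PredSym.profile :=
    Primrec.snd.comp (Primrec.of_equiv (e := PredSym.equiv))
  have hpred : PrimrecRel fun (_ : FreeAtom) (p : PredSym × List Arg) =>
      p.2.map Arg.sort = p.1.profile :=
    PrimrecRel.comp Primrec.eq
      (Primrec.list_map (Primrec.snd.comp .snd) (hsort.comp .snd).to₂)
      (hprofile.comp (Primrec.fst.comp .snd))
  have heqn : PrimrecRel fun (_ : FreeAtom) (_ : FreeTerm × FreeTerm) => True :=
    (PrimrecRel.comp Primrec.eq (Primrec.const 0) (Primrec.const 0)).of_eq fun _ => by simp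
  refine (primrecPred_sumElim (Primrec.of_equiv (e := FreeAtom.equiv)) heqn hpred).of_eq
    fun a => ?_
  cases a <;> rfl

/-- The constraint is of the form `x ◁ c` with the given `x` and `◁`. -/
def Constraint.Bounds (x : ℕ) (r : Rel) : Constraint → Prop
  | .varConst y r' _ => y = x ∧ r' = r
  | _ => False

/-- This trades a quantifier over all rationals for one over the entries of a list. -/
theorem exists_mem_bounds {l : List Constraint} {x : ℕ} {r : Rel} :
    (∃ a ∈ l, a.Bounds x r) ↔ ∃ c, Constraint.varConst x r c ∈ l := by
  constructor
  · rintro ⟨_ | _ | _, ha, h⟩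
    · obtain ⟨rfl, rfl⟩ := h
      exact ⟨_, ha⟩
    · exact h.elim
    · exact h.elim
  · rintro ⟨c, h⟩
    exact ⟨_, h, rfl, rfl⟩

theorem primrecPred_const_false : PrimrecPred fun _ : γ => False :=
  (PrimrecRel.comp Primrec.eq (Primrec.const 0) (Primrec.const 1)).of_eq fun _ => by simp

theorem primrecPred_const_true : PrimrecPred fun _ : γ => True :=
  (PrimrecRel.comp Primrec.eq (Primrec.const 0) (Primrec.const 0)).of_eq fun _ => by simp

theorem primrecPred_exists_bounds {l : γ → List Constraint} {x : γ → ℕ} (hl : Primrec l)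
    (hx : Primrec x) (r : Rel) : PrimrecPred fun z => ∃ c, Constraint.varConst (x z) r c ∈ l z := by
  have hconst : PrimrecRel fun (z : γ × Constraint) (p : ℕ × Rel × ℚ) => p.1 = x z.1 ∧ p.2.1 = r :=
    (PrimrecRel.comp Primrec.eq (Primrec.fst.comp .snd)
      (hx.comp (Primrec.fst.comp .fst))).and
    (PrimrecRel.comp Primrec.eq (Primrec.fst.comp (Primrec.snd.comp .snd)) (Primrec.const r))
  have h : PrimrecRel fun (z : γ) (a : Constraint) => a.Bounds (x z) r := by
    refine (primrecPred_sumElim (γ := γ × Constraint)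
      ((Primrec.of_equiv (e := Constraint.equiv)).comp .snd) hconst
        (q := fun _ _ => False) primrecPred_const_false).of_eq fun z => ?_
    obtain ⟨z, _ | _ | _⟩ := z <;> rfl
  exact (primrecPred_exists_mem hl h).of_eq fun z => exists_mem_bounds

def Constraint.IsBounded (l : List Constraint) : Constraint → Prop
  | .diff x y _ _ => ((∃ c, Constraint.varConst x .ge c ∈ l) ∧ ∃ c, Constraint.varConst x .le c ∈ l) ∧
      (∃ c, Constraint.varConst y .ge c ∈ l) ∧ ∃ c, Constraint.varConst y .le c ∈ l
  | _ => True

theorem primrecPred_isBounded {l : γ → List Constraint} {a : γ → Constraint} (hl : Primrec l)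
    (ha : Primrec a) : PrimrecPred fun z => (a z).IsBounded (l z) := by
  have hl' := hl.comp (Primrec.fst.comp (Primrec.fst (α := γ × ((ℕ × Rel × ℕ) ⊕ (ℕ × ℕ × Rel × ℚ)))
    (β := ℕ × ℕ × Rel × ℚ)))
  have h1 := Primrec.fst.comp (Primrec.snd (α := γ × ((ℕ × Rel × ℕ) ⊕ (ℕ × ℕ × Rel × ℚ)))
    (β := ℕ × ℕ × Rel × ℚ))
  have h2 := Primrec.fst.comp (Primrec.snd.comp (Primrec.snd
    (α := γ × ((ℕ × Rel × ℕ) ⊕ (ℕ × ℕ × Rel × ℚ))) (β := ℕ × ℕ × Rel × ℚ)))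
  have hdiff := ((primrecPred_exists_bounds hl' h1 .ge).and
    (primrecPred_exists_bounds hl' h1 .le)).and
    ((primrecPred_exists_bounds hl' h2 .ge).and (primrecPred_exists_bounds hl' h2 .le))
  have hrest := primrecPred_sumElim (γ := γ × ((ℕ × Rel × ℕ) ⊕ (ℕ × ℕ × Rel × ℚ))) .snd
    (p := fun _ _ => True) primrecPred_const_true hdiff.primrecRel
  refine (primrecPred_sumElim ((Primrec.of_equiv (e := Constraint.equiv)).comp ha)
    (p := fun _ _ => True) primrecPred_const_true hrest.primrecRel).of_eq fun z => ?_
  cases a z <;> rfl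

theorem Clause.isBSRBD_iff (C : Clause) : C.IsBSRBD ↔ (∀ a ∈ C.antecedent, a.WellSorted) ∧
    (∀ a ∈ C.succedent, a.WellSorted) ∧ ∀ a ∈ C.constraints, a.IsBounded C.constraints := by
  constructor
  · rintro ⟨h1, h2, h3⟩
    refine ⟨h1, h2, ?_⟩
    rintro (_ | _ | ⟨x, y, r, c⟩) h
    · trivial
    · trivial
    · obtain ⟨cx, dx, cy, dy, h⟩ := h3 x y r c h
      exact ⟨⟨⟨cx, h.1⟩, ⟨dx, h.2.1⟩⟩, ⟨cy, h.2.2.1⟩, ⟨dy, h.2.2.2⟩⟩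
  · rintro ⟨h1, h2, h3⟩
    refine ⟨h1, h2, fun x y r c h => ?_⟩
    obtain ⟨⟨⟨cx, hcx⟩, ⟨dx, hdx⟩⟩, ⟨cy, hcy⟩, ⟨dy, hdy⟩⟩ := h3 _ h
    exact ⟨cx, dx, cy, dy, hcx, hdx, hcy, hdy⟩

theorem primrecPred_isBSRBD : PrimrecPred ClauseSet.IsBSRBD := by
  have hC : PrimrecPred Clause.IsBSRBD :=
    ((primrecPred_wellSorted.forall_mem_list.comp primrec_antecedent).and
      ((primrecPred_wellSorted.forall_mem_list.comp primrec_succedent).and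
        (primrecPred_forall_mem primrec_constraints (primrecPred_isBounded
          (primrec_constraints.comp .fst) .snd).primrecRel))).of_eq fun C => C.isBSRBD_iff.symm
  exact hC.forall_mem_list

end Primrec

/-! ### The code of a clause set bounds everything that occurs in it -/

theorem encode_lt_of_mem {α : Type*} [Encodable α] {a : α} {l : List α} (h : a ∈ l) :
    encode a < encode l := by
  induction l with
  | nil => cases h
  | cons b l ih =>
    rw [encode_list_cons, Nat.lt_succ_iff]
    rcases List.mem_cons.1 h with rfl | h
    · exact Nat.left_le_pair _ _
    · exact (ih h).le.trans (Nat.right_le_pair _ _)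

theorem natAbs_num_le_encode (c : ℚ) : c.num.natAbs ≤ encode c := by
  have h : encode c = Nat.pair (encode c.num) c.den := rfl
  have := natAbs_eq_encode c.num
  have := Nat.left_le_pair (encode c.num) c.den
  omega

theorem den_le_encode (c : ℚ) : c.den ≤ encode c :=
  Nat.right_le_pair (encode c.num) c.den

/-- Numerators matter only for `x ◁ c`, where compression has to fix `c`. For a difference
constraint it is enough that `E!` clears the denominator. -/
def Constraint.Below (E : ℕ) : Constraint → Prop
  | .varConst x _ c => x < E ∧ c.num.natAbs < E ∧ c.den < E
  | .varVar x _ y => x < E ∧ y < E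
  | .diff x y _ c => x < E ∧ y < E ∧ c.den < E

def FreeTerm.Below (E : ℕ) : FreeTerm → Prop
  | .var n => n < E
  | .const n => n < E

def Arg.Below (E : ℕ) : Arg → Prop
  | .base n => n < E
  | .free t => t.Below E

def FreeAtom.Below (E : ℕ) : FreeAtom → Prop
  | .eqn s t => s.Below E ∧ t.Below E
  | .pred P args => encode P < E ∧ args.length < E ∧ ∀ a ∈ args, a.Below E

/-- All indices and the sizes of all rational constants in `C` are less than `E`. -/
structure Clause.Below (E : ℕ) (C : Clause) : Prop where
  constraints : ∀ a ∈ C.constraints, a.Below E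
  antecedent : ∀ a ∈ C.antecedent, a.Below E
  succedent : ∀ a ∈ C.succedent, a.Below E

theorem Constraint.below_of_encode_lt {E : ℕ} {a : Constraint} (h : encode a < E) : a.Below E := by
  cases a with
  | varConst x r c =>
    have h1 : encode (Constraint.varConst x r c) = 2 * Nat.pair x (Nat.pair (encode r) (encode c)) :=
      rfl
    have h2 := Nat.left_le_pair x (Nat.pair (encode r) (encode c))
    have h3 := Nat.right_le_pair x (Nat.pair (encode r) (encode c))
    have h4 := Nat.right_le_pair (encode r) (encode c)
    have h5 := natAbs_num_le_encode c
    have h6 := den_le_encode c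
    exact ⟨by omega, by omega, by omega⟩
  | varVar x r y =>
    have h1 : encode (Constraint.varVar x r y) =
      2 * (2 * Nat.pair x (Nat.pair (encode r) y)) + 1 := rfl
    have h2 := Nat.left_le_pair x (Nat.pair (encode r) y)
    have h3 := Nat.right_le_pair x (Nat.pair (encode r) y)
    have h4 := Nat.right_le_pair (encode r) y
    exact ⟨by omega, by omega⟩
  | diff x y r c =>
    have h1 : encode (Constraint.diff x y r c) =
      2 * (2 * Nat.pair x (Nat.pair y (Nat.pair (encode r) (encode c))) + 1) + 1 := rfl
    have h2 := Nat.left_le_pair x (Nat.pair y (Nat.pair (encode r) (encode c)))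
    have h3 := Nat.right_le_pair x (Nat.pair y (Nat.pair (encode r) (encode c)))
    have h4 := Nat.left_le_pair y (Nat.pair (encode r) (encode c))
    have h5 := Nat.right_le_pair y (Nat.pair (encode r) (encode c))
    have h6 := Nat.right_le_pair (encode r) (encode c)
    have h7 := den_le_encode c
    exact ⟨by omega, by omega, by omega⟩

theorem FreeTerm.below_of_encode_lt {E : ℕ} {t : FreeTerm} (h : encode t < E) : t.Below E := by
  cases t with
  | var n =>
    have h1 : encode (FreeTerm.var n) = 2 * n := rfl
    exact show n < E by omega
  | const n =>
    have h1 : encode (FreeTerm.const n) = 2 * n + 1 := rfl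
    exact show n < E by omega

theorem Arg.below_of_encode_lt {E : ℕ} {a : Arg} (h : encode a < E) : a.Below E := by
  cases a with
  | base n =>
    have h1 : encode (Arg.base n) = 2 * n := rfl
    exact show n < E by omega
  | free t =>
    have h1 : encode (Arg.free t) = 2 * encode t + 1 := rfl
    exact FreeTerm.below_of_encode_lt (by omega)

theorem FreeAtom.below_of_encode_lt {E : ℕ} {a : FreeAtom} (h : encode a < E) : a.Below E := by
  cases a with
  | eqn s t =>
    have h1 : encode (FreeAtom.eqn s t) = 2 * Nat.pair (encode s) (encode t) := rfl
    have h2 := Nat.left_le_pair (encode s) (encode t)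
    have h3 := Nat.right_le_pair (encode s) (encode t)
    exact ⟨FreeTerm.below_of_encode_lt (by omega), FreeTerm.below_of_encode_lt (by omega)⟩
  | pred P args =>
    have h1 : encode (FreeAtom.pred P args) = 2 * Nat.pair (encode P) (encode args) + 1 := rfl
    have h2 := Nat.left_le_pair (encode P) (encode args)
    have h3 := Nat.right_le_pair (encode P) (encode args)
    have h4 := length_le_encode args
    refine ⟨by omega, by omega, fun a ha => Arg.below_of_encode_lt ?_⟩
    have h5 := encode_lt_of_mem ha
    omega

theorem Clause.below_of_encode_lt {E : ℕ} {C : Clause} (h : encode C < E) : C.Below E := by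
  have h1 : encode C = Nat.pair (encode C.constraints)
    (Nat.pair (encode C.antecedent) (encode C.succedent)) := rfl
  have h2 := Nat.left_le_pair (encode C.constraints)
    (Nat.pair (encode C.antecedent) (encode C.succedent))
  have h3 := Nat.right_le_pair (encode C.constraints)
    (Nat.pair (encode C.antecedent) (encode C.succedent))
  have h4 := Nat.left_le_pair (encode C.antecedent) (encode C.succedent)
  have h5 := Nat.right_le_pair (encode C.antecedent) (encode C.succedent)
  refine ⟨fun a ha => Constraint.below_of_encode_lt ?_,
    fun a ha => FreeAtom.below_of_encode_lt ?_, fun a ha => FreeAtom.below_of_encode_lt ?_⟩ <;>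
  · have := encode_lt_of_mem ha
    omega

theorem ClauseSet.below {N : ClauseSet} {C : Clause} (hC : C ∈ N) : C.Below (encode N + 1) :=
  Clause.below_of_encode_lt ((encode_lt_of_mem hC).trans (Nat.lt_succ_self _))

/-! ### Points and constraints -/

theorem denom_pos (E : ℕ) : 0 < denom E := Nat.mul_pos (Nat.factorial_pos E) E.succ_pos

/-- All six relations are determined by the two strict comparisons. -/
theorem Rel.holds_congr {a b a' b' : ℝ} (h1 : a < b ↔ a' < b') (h2 : b < a ↔ b' < a') (r : Rel) :
    r.Holds a b ↔ r.Holds a' b' := by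
  have h3 : a ≤ b ↔ a' ≤ b' := by rw [← not_lt, ← not_lt, h2]
  have h4 : b ≤ a ↔ b' ≤ a' := by rw [← not_lt, ← not_lt, h1]
  cases r <;> simp only [Rel.Holds, ge_iff_le, gt_iff_lt, le_antisymm_iff, ne_eq, h1, h2, h3, h4]

/-- Multiplying the difference of the two sides by a positive number. -/
theorem Rel.holds_of_sub_eq {a b a' b' k : ℝ} (hk : 0 < k) (h : a' - b' = k * (a - b)) (r : Rel) :
    r.Holds a' b' ↔ r.Holds a b := by
  refine Rel.holds_congr ?_ ?_ r
  · rw [← sub_neg, h, mul_neg_iff, ← sub_neg (a := a)]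
    simp [hk, not_lt.2 hk.le]
  · rw [← sub_pos, h, mul_pos_iff, ← sub_pos (b := b)]
    simp [hk, not_lt.2 hk.le]

theorem Constraint.check_iff (E : ℕ) (b : List ℕ) (a : Constraint) :
    a.Check E b ↔ a.Holds fun x => pos E (b.getD x 0) := by
  have hD : (0 : ℝ) < denom E := by exact_mod_cast denom_pos E
  have hc (c : ℚ) : (0 : ℝ) < c.den := by exact_mod_cast c.den_pos
  have hz (c : ℚ) : ((c.num.toNat : ℝ) - ((-c.num).toNat : ℝ)) = c * c.den := by
    have h1 : ((c.num.toNat : ℤ) - ((-c.num).toNat : ℤ)) = c.num := by omega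
    have h2 : ((c.num.toNat : ℝ) - ((-c.num).toNat : ℝ)) = (c.num : ℝ) := by exact_mod_cast h1
    have h3 : (c : ℝ) * c.den = c.num := by exact_mod_cast Rat.mul_den_eq_num c
    rw [h2, h3]
  cases a with
  | varConst x r c =>
    refine Rel.holds_of_sub_eq (mul_pos (hc c) hD) ?_ r
    have := hz c
    simp only [pos]
    push_cast
    field_simp
    linear_combination (-(denom E : ℝ)) * this
  | varVar x r y =>
    refine Rel.holds_of_sub_eq hD ?_ r
    simp only [pos]
    field_simp
    ring
  | diff x y r c =>
    refine Rel.holds_of_sub_eq (mul_pos (hc c) hD) ?_ r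
    have := hz c
    simp only [pos]
    push_cast
    field_simp
    linear_combination (-(denom E : ℝ)) * this

/-! ### Constraints only see integer parts and the order of fractional parts -/

/-- The real number with integer part `q` and fractional part `f` in the scale of level `E`. -/
noncomputable def realPos (E q : ℕ) (f : ℝ) : ℝ := (q + f) / E.factorial - (E + 1)

theorem pos_eq_realPos (E n : ℕ) :
    pos E n = realPos E (n / (E + 1)) ((n % (E + 1) : ℕ) / ((E : ℝ) + 1)) := by
  have h1 : ((E + 1 : ℕ) : ℝ) * (n / (E + 1) : ℕ) + (n % (E + 1) : ℕ) = n := by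
    exact_mod_cast Nat.div_add_mod n (E + 1)
  have h2 : (E.factorial : ℝ) ≠ 0 := by exact_mod_cast E.factorial_ne_zero
  have h3 : (E : ℝ) + 1 ≠ 0 := by positivity
  rw [pos, realPos, denom, ← h1]
  push_cast
  field_simp

/-- For integers `m`, `C` and `|δ| < 1`, the inequality `m + δ < C` means `m < C`, or `m = C` and `δ
< 0`. Only the sign of `δ` enters. -/
theorem intCast_add_lt_iff {δ ε : ℝ} (hδ : δ < 1) (hδ' : -1 < δ) (hε : ε < 1) (hε' : -1 < ε)
    (h : δ < 0 ↔ ε < 0) (m C : ℤ) : m + δ < C ↔ m + ε < C := by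
  have key {δ : ℝ} (hδ : δ < 1) (hδ' : -1 < δ) : m + δ < C ↔ m < C ∨ m = C ∧ δ < 0 := by
    rcases lt_trichotomy m C with hm | hm | hm
    · have : (m : ℝ) + 1 ≤ C := by exact_mod_cast hm
      simp only [hm, true_or, iff_true]
      linarith
    · subst hm
      simp
    · have : (C : ℝ) + 1 ≤ m := by exact_mod_cast hm
      simp only [hm.not_gt, hm.ne', false_and, or_self, iff_false, not_lt]
      linarith
  rw [key hδ hδ', key hε hε', h]

theorem Rel.holds_intCast_iff {δ ε : ℝ} (hδ : δ < 1) (hδ' : -1 < δ) (hε : ε < 1) (hε' : -1 < ε)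
    (h : δ < 0 ↔ ε < 0) (h' : 0 < δ ↔ 0 < ε) (m C : ℤ) (r : Rel) :
    r.Holds (m + δ) C ↔ r.Holds (m + ε) C := by
  refine Rel.holds_congr (intCast_add_lt_iff hδ hδ' hε hε' h m C) ?_ r
  have := intCast_add_lt_iff (δ := -δ) (ε := -ε) (by linarith) (by linarith) (by linarith)
    (by linarith) (by simpa using h') (-m) (-C)
  push_cast at this
  constructor
  · intro h
    linarith [this.1 (by linarith)]
  · intro h
    linarith [this.2 (by linarith)]

theorem exists_factorial_mul_eq {E : ℕ} {c : ℚ} (h : c.den < E) :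
    ∃ z : ℤ, (E.factorial : ℝ) * c = z := by
  obtain ⟨k, hk⟩ := Nat.dvd_factorial c.den_pos h.le
  refine ⟨k * c.num, ?_⟩
  have h3 : (c : ℝ) * c.den = c.num := by exact_mod_cast Rat.mul_den_eq_num c
  rw [hk]
  push_cast
  rw [← h3]
  ring

/-- Scaling by `E!` turns each constraint into a comparison of an integer plus `δ` with an integer.
Here `δ` is a fractional part or a difference of two, and its sign is given by the order of
fractional parts and their comparison with 0. -/
theorem Constraint.holds_congr {E : ℕ} {a : Constraint} (ha : a.Below E) {q : ℕ → ℕ}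
    {f g : ℕ → ℝ} (hf : ∀ x, 0 ≤ f x ∧ f x < 1) (hg : ∀ x, 0 ≤ g x ∧ g x < 1)
    (h0 : ∀ x < E, 0 < f x ↔ 0 < g x) (h : ∀ x < E, ∀ y < E, f x < f y ↔ g x < g y) :
    a.Holds (fun x => realPos E (q x) (f x)) ↔ a.Holds (fun x => realPos E (q x) (g x)) := by
  have hD : (0 : ℝ) < E.factorial := by exact_mod_cast E.factorial_pos
  have hdiff {x y : ℕ} (hx : x < E) (hy : y < E) (r : Rel) (C : ℤ) :
      r.Holds (((q x - q y : ℤ) : ℝ) + (f x - f y)) C ↔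
        r.Holds (((q x - q y : ℤ) : ℝ) + (g x - g y)) C := by
    have := hf x; have := hf y; have := hg x; have := hg y
    refine Rel.holds_intCast_iff (by linarith) (by linarith) (by linarith) (by linarith) ?_ ?_ _ C r
    · simpa using h x hx y hy
    · simpa using h y hy x hx
  cases a with
  | varConst x r c =>
    obtain ⟨z, hz⟩ := exists_factorial_mul_eq ha.2.2
    have key (f : ℕ → ℝ) : (((q x : ℤ) : ℝ) + f x) - ((z + E.factorial * (E + 1) : ℤ) : ℝ) =
        E.factorial * (realPos E (q x) (f x) - c) := by
      push_cast
      rw [← hz, realPos]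
      field_simp
      ring
    have := hf x; have := hg x
    rw [Constraint.Holds, Constraint.Holds, ← Rel.holds_of_sub_eq hD (key f),
      ← Rel.holds_of_sub_eq hD (key g)]
    refine Rel.holds_intCast_iff (by linarith) (by linarith) (by linarith) (by linarith) ?_
      (h0 x ha.1) _ _ r
    exact ⟨fun h => by linarith, fun h => by linarith⟩
  | varVar x r y =>
    have key (f : ℕ → ℝ) : (((q x - q y : ℤ) : ℝ) + (f x - f y)) - ((0 : ℤ) : ℝ) =
        E.factorial * (realPos E (q x) (f x) - realPos E (q y) (f y)) := by
      push_cast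
      rw [realPos, realPos]
      field_simp
      ring
    rw [Constraint.Holds, Constraint.Holds, ← Rel.holds_of_sub_eq hD (key f),
      ← Rel.holds_of_sub_eq hD (key g)]
    exact hdiff ha.1 ha.2 r 0
  | diff x y r c =>
    obtain ⟨z, hz⟩ := exists_factorial_mul_eq ha.2.2
    have key (f : ℕ → ℝ) : (((q x - q y : ℤ) : ℝ) + (f x - f y)) - (z : ℝ) =
        E.factorial * ((realPos E (q x) (f x) - realPos E (q y) (f y)) - c) := by
      push_cast
      rw [← hz, realPos, realPos]
      field_simp
      ring
    rw [Constraint.Holds, Constraint.Holds, ← Rel.holds_of_sub_eq hD (key f),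
      ← Rel.holds_of_sub_eq hD (key g)]
    exact hdiff ha.1 ha.2.1 r z

/-- The constraints cannot distinguish the points `b` from reals with the same integer parts and
the same order of fractional parts. -/
theorem Constraint.check_iff_holds {E : ℕ} {a : Constraint} (ha : a.Below E) {b : List ℕ}
    {f : ℕ → ℝ} (hf : ∀ x, 0 ≤ f x ∧ f x < 1)
    (h0 : ∀ x < E, 0 < f x ↔ 0 < (pointVal E (b.getD x 0)).2)
    (h : ∀ x < E, ∀ y < E,
      f x < f y ↔ (pointVal E (b.getD x 0)).2 < (pointVal E (b.getD y 0)).2) :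
    a.Check E b ↔ a.Holds fun x => realPos E (b.getD x 0 / (E + 1)) (f x) := by
  have hE : (0 : ℝ) < (E : ℝ) + 1 := by positivity
  rw [Constraint.check_iff]
  simp only [pos_eq_realPos]
  refine Constraint.holds_congr ha (fun x => ⟨by positivity, ?_⟩) hf (fun x hx => ?_)
    fun x hx y hy => ?_
  · rw [div_lt_one hE]
    exact_mod_cast Nat.mod_lt _ E.succ_pos
  · rw [h0 x hx, div_pos_iff_of_pos_right hE, Nat.cast_pos]
    rfl
  · rw [h x hx y hy, div_lt_div_iff_of_pos_right hE, Nat.cast_lt]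
    rfl

/-! ### Similarity of lists of ground arguments -/

section Sim

variable {α β γ : Type*} [Zero α] [LT α] [Zero β] [LT β] [Zero γ] [LT γ]

theorem Sim.refl (a : List (GVal α)) : Sim a a := ⟨rfl, fun _ => ⟨rfl, fun _ => Iff.rfl⟩⟩

theorem Sim.symm {a : List (GVal α)} {b : List (GVal β)} (h : Sim a b) : Sim b a :=
  ⟨h.1.symm, fun i => ⟨(h.2 i).1.symm, fun j => ((h.2 i).2 j).symm⟩⟩

theorem Sim.trans {a : List (GVal α)} {b : List (GVal β)} {c : List (GVal γ)} (h : Sim a b)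
    (h' : Sim b c) : Sim a c :=
  ⟨h.1.trans h'.1, fun i => ⟨(h.2 i).1.trans (h'.2 i).1, fun j => ((h.2 i).2 j).trans ((h'.2 i).2 j)⟩⟩

/-- The comparisons with 0 are required because `Sim` also compares entries with the default beyond
the end of the list. -/
theorem Sim.map {δ : Type*} {l : List δ} {u : δ → GVal α} {v : δ → GVal β}
    (h1 : ∀ x ∈ l, (u x).1 = (v x).1) (h2 : ∀ x ∈ l, 0 < (u x).2 ↔ 0 < (v x).2)
    (h3 : ∀ x ∈ l, (u x).2 < 0 ↔ (v x).2 < 0)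
    (h4 : ∀ x ∈ l, ∀ y ∈ l, (u x).2 < (u y).2 ↔ (v x).2 < (v y).2)
    (h5 : (0 : α) < 0 ↔ (0 : β) < 0) : Sim (l.map u) (l.map v) := by
  have key (i : ℕ) : ((l.map u).getD i (.inl 0, 0) = (.inl 0, 0) ∧
      (l.map v).getD i (.inl 0, 0) = (.inl 0, 0)) ∨ ∃ x ∈ l,
        (l.map u).getD i (.inl 0, 0) = u x ∧ (l.map v).getD i (.inl 0, 0) = v x := by
    rcases lt_or_ge i l.length with hi | hi
    · refine .inr ⟨l[i], l.getElem_mem hi, ?_, ?_⟩ <;> simp [hi]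
    · refine .inl ⟨?_, ?_⟩ <;> exact List.getD_eq_default _ _ (by simpa)
  refine ⟨by simp, fun i => ?_⟩
  rcases key i with ⟨e1, e2⟩ | ⟨x, hx, e1, e2⟩ <;> rw [e1, e2]
  · refine ⟨rfl, fun j => ?_⟩
    rcases key j with ⟨e1, e2⟩ | ⟨y, hy, e1, e2⟩ <;> rw [e1, e2]
    · exact h5
    · exact h2 y hy
  · refine ⟨h1 x hx, fun j => ?_⟩
    rcases key j with ⟨e1, e2⟩ | ⟨y, hy, e1, e2⟩ <;> rw [e1, e2]
    · exact h3 x hx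
    · exact h4 x hx y hy

end Sim

/-! ### The finite stock of ground values and ground atoms -/

theorem inl_mem_groundValues {E q r : ℕ} :
    (.inl q, r) ∈ groundValues E ↔ q < 2 * (E + 1) * E.factorial ∧ r ≤ E := by
  simp only [groundValues, List.mem_append, List.mem_map, List.mem_range, pointVal, Prod.mk.injEq,
    Sum.inl.injEq, reduceCtorEq, false_and, and_false, exists_false, or_false]
  have hn : numPoints E = 2 * (E + 1) * E.factorial * (E + 1) := by rw [numPoints, denom]; ring
  rw [hn]
  constructor
  · rintro ⟨n, hn, rfl, rfl⟩
    exact ⟨Nat.div_lt_of_lt_mul (by rwa [mul_comm]), Nat.lt_succ_iff.1 (Nat.mod_lt _ E.succ_pos)⟩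
  · rintro ⟨hq, hr⟩
    refine ⟨q * (E + 1) + r, ?_, ?_, ?_⟩
    · calc q * (E + 1) + r < (q + 1) * (E + 1) := by rw [add_mul]; omega
        _ ≤ _ := Nat.mul_le_mul_right _ hq
    · rw [mul_comm, Nat.mul_add_div E.succ_pos, Nat.div_eq_of_lt (by omega), add_zero]
    · rw [mul_comm, Nat.mul_add_mod, Nat.mod_eq_of_lt (by omega)]

theorem inr_mem_groundValues {E e r : ℕ} : (.inr e, r) ∈ groundValues E ↔ e < E ∧ r = 0 := by
  simp [groundValues, pointVal, eq_comm]

theorem mem_groundAtoms {E c : ℕ} {a : List (GVal ℕ)} :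
    (c, a) ∈ groundAtoms E ↔ c < E ∧ a.length ≤ E ∧ ∀ x ∈ a, x ∈ groundValues E := by
  simp only [groundAtoms, List.mem_flatMap, List.mem_range, List.mem_map, mem_listsUpTo,
    Prod.mk.injEq]
  constructor
  · rintro ⟨c, hc, a, ha, rfl, rfl⟩
    exact ⟨hc, ha⟩
  · rintro ⟨hc, ha⟩
    exact ⟨c, hc, a, ha, rfl, rfl⟩

/-! ### Homogeneous sequences -/

/-- The limit truth value of `Q` on lists of length `l`. -/
def Lim (U : Filter ℕ) : ℕ → (List ℕ → Prop) → Prop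
  | 0, Q => Q []
  | l + 1, Q => ∀ᶠ n in U, Lim U l fun p => Q (n :: p)

/-- The sequence is chosen greedily along a nonprincipal ultrafilter: almost every `a` gives each
section `Q i (a :: ·)` the limit truth value of `Q i`, and only finitely many sections and lengths
are in play. -/
theorem exists_forall_sublist_iff_lim {U : Ultrafilter ℕ} (hU : (U : Filter ℕ) ≤ Filter.atTop)
    (n : ℕ) : ∀ {ι : Type} [Finite ι] (Q : ι → List ℕ → Prop) (m : ℕ),
      ∃ g : List ℕ, g.length = n ∧ g.Pairwise (· < ·) ∧ (∀ x ∈ g, m < x) ∧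
        ∀ i p, p.Sublist g → (Q i p ↔ Lim U p.length (Q i)) := by
  induction n with
  | zero =>
    intro ι _ Q m
    refine ⟨[], rfl, .nil, by simp, fun i p hp => ?_⟩
    rw [List.sublist_nil.1 hp]
    exact Iff.rfl
  | succ n ih =>
    intro ι _ Q m
    have hdec (i : ι) (l : ℕ) : ∀ᶠ a in (U : Filter ℕ),
        (Lim U l fun p => Q i (a :: p)) ↔ Lim U (l + 1) (Q i) := by
      by_cases h : Lim U (l + 1) (Q i)
      · filter_upwards [show ∀ᶠ a in (U : Filter ℕ), Lim U l fun p => Q i (a :: p) from h]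
          with a ha
        exact iff_of_true ha h
      · have h' : ¬ ∀ᶠ a in (U : Filter ℕ), Lim U l fun p => Q i (a :: p) := h
        filter_upwards [Ultrafilter.eventually_not.2 h'] with a ha
        exact iff_of_false ha h
    have hall : ∀ᶠ a in (U : Filter ℕ), m < a ∧ ∀ i, ∀ l ∈ Set.Iic n,
        ((Lim U l fun p => Q i (a :: p)) ↔ Lim U (l + 1) (Q i)) :=
      Filter.Eventually.and (Filter.Eventually.filter_mono hU (Filter.eventually_gt_atTop m)) (Filter.eventually_all.2 fun i =>
        (Filter.eventually_all_finite (Set.finite_Iic n)).2 fun l _ => hdec i l)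
    obtain ⟨a, hma, ha⟩ := hall.exists
    obtain ⟨g, hlen, hsort, hgt, hg⟩ :=
      -- The sections at `a` join the family, so that later choices also control the tuples
      -- beginning with `a`.
      ih (Sum.elim Q fun i p => Q i (a :: p)) a
    refine ⟨a :: g, by simp [hlen], List.pairwise_cons.2 ⟨hgt, hsort⟩, ?_, fun i p hp => ?_⟩
    · simp only [List.mem_cons, forall_eq_or_imp]
      exact ⟨hma, fun x hx => hma.trans (hgt x hx)⟩
    · rcases List.sublist_cons_iff.1 hp with h | ⟨t, rfl, ht⟩
      · exact hg (.inl i) p h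
      · rw [List.length_cons, ← ha i t.length (hlen ▸ ht.length_le)]
        exact hg (.inr i) t ht

/-- Finite Ramsey theorem for finitely many properties of increasing tuples. -/
theorem exists_homogeneous {ι : Type} [Finite ι] (Q : ι → List ℕ → Prop) (n : ℕ) :
    ∃ g : List ℕ, g.length = n ∧ g.Pairwise (· < ·) ∧
      ∀ i p p', p.Sublist g → p'.Sublist g → p.length = p'.length → (Q i p ↔ Q i p') := by
  obtain ⟨g, h1, h2, -, h3⟩ :=
    exists_forall_sublist_iff_lim (U := Filter.hyperfilter ℕ) Nat.hyperfilter_le_atTop n Q 0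
  exact ⟨g, h1, h2, fun i p p' hp hp' h => by rw [h3 i p hp, h3 i p' hp', h]⟩

/-! ### List lookup with a default value -/

theorem getD_mem_cons {α : Type*} (l : List α) (n : ℕ) (d : α) : l.getD n d ∈ d :: l := by
  rcases lt_or_ge n l.length with h | h
  · rw [List.getD_eq_getElem _ _ h]
    exact List.mem_cons_of_mem _ (List.getElem_mem h)
  · rw [List.getD_eq_default _ _ h]
    exact List.mem_cons_self

theorem getD_map_range {α : Type*} (f : ℕ → α) (d : α) {E n : ℕ} (h : n < E) :
    ((List.range E).map f).getD n d = f n := by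
  rw [List.getD_eq_getElem _ _ (by simpa)]
  simp

/-! ### Compressing the reals to a bounded interval -/

noncomputable def clamp (E : ℕ) (x : ℝ) : ℝ := max (-E) (min x E)

/-- A strictly increasing map of `ℝ` into `(-(E + 1), E + 1)` that fixes `[-E, E]`. -/
noncomputable def compress (E : ℕ) (x : ℝ) : ℝ :=
  clamp E x + (orderIsoIooNegOneOne ℝ (x - clamp E x) : ℝ)

theorem clamp_mono {E : ℕ} {x y : ℝ} (h : x ≤ y) :
    clamp E x ≤ clamp E y ∧ x - clamp E x ≤ y - clamp E y := by
  have : (0 : ℝ) ≤ E := E.cast_nonneg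
  unfold clamp
  constructor
  · gcongr
  · rcases max_cases (-(E : ℝ)) (min x E) with h1 | h1 <;>
      rcases max_cases (-(E : ℝ)) (min y E) with h2 | h2 <;>
      rcases min_cases x (E : ℝ) with h3 | h3 <;>
      rcases min_cases y (E : ℝ) with h4 | h4 <;> linarith

/-- A number is its clamped part plus a remainder, both monotone in it. When the number grows, one
of them grows strictly, and squeezing the remainder into `(-1, 1)` preserves this. -/
theorem compress_strictMono (E : ℕ) : StrictMono (compress E) := by
  intro x y h
  obtain ⟨h1, h2⟩ := clamp_mono (E := E) h.le
  rcases h1.lt_or_eq with h1 | h1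
  · exact add_lt_add_of_lt_of_le h1 ((orderIsoIooNegOneOne ℝ).monotone h2)
  · exact add_lt_add_of_le_of_lt h1.le ((orderIsoIooNegOneOne ℝ).strictMono (by rw [h1]; linarith))

theorem compress_eq_self {E : ℕ} {x : ℝ} (h : -(E : ℝ) ≤ x) (h' : x ≤ E) : compress E x = x := by
  have : clamp E x = x := by rw [clamp, min_eq_left h', max_eq_right h]
  rw [compress, this, sub_self]
  simp [orderIsoIooNegOneOne, Set.codRestrict]

theorem compress_bounds (E : ℕ) (x : ℝ) : -((E : ℝ) + 1) < compress E x ∧ compress E x < E + 1 := by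
  have h0 : (0 : ℝ) ≤ E := E.cast_nonneg
  have h1 := (orderIsoIooNegOneOne ℝ (x - clamp E x)).2.1
  have h2 := (orderIsoIooNegOneOne ℝ (x - clamp E x)).2.2
  have h3 : -(E : ℝ) ≤ clamp E x := le_max_left _ _
  have h4 : clamp E x ≤ E := max_le (by linarith) (min_le_right _ _)
  unfold compress
  constructor <;> linarith

theorem abs_cast_le {E : ℕ} {c : ℚ} (h : c.num.natAbs < E) : -(E : ℝ) ≤ c ∧ (c : ℝ) ≤ E := by
  have h1 : |(c.num : ℝ)| ≤ E := by
    rw [← Int.cast_abs, Int.abs_eq_natAbs]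
    exact_mod_cast h.le
  have h2 : |(c : ℝ)| ≤ |(c.num : ℝ)| := by
    have h3 : (c : ℝ) * c.den = c.num := by exact_mod_cast Rat.mul_den_eq_num c
    have h4 : (1 : ℝ) ≤ c.den := by exact_mod_cast c.den_pos
    rw [← h3, abs_mul, abs_of_nonneg (by linarith : (0 : ℝ) ≤ c.den)]
    exact le_mul_of_one_le_right (abs_nonneg _) h4
  exact abs_le.1 (h2.trans h1)

/-- Comparisons survive since compression is strictly increasing and fixes the constants.
Differences survive since their variables, bounded on both sides by constants in `[-E, E]`, do not
move: this is where condition (2) on clauses enters. -/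
theorem holds_compress {E : ℕ} {C : Clause} (hC : C.IsBSRBD) (hb : C.Below E) {β : ℕ → ℝ}
    (h : ∀ a ∈ C.constraints, a.Holds β) :
    ∀ a ∈ C.constraints, a.Holds fun x => compress E (β x) := by
  have hm := compress_strictMono E
  have hfix {x : ℕ} {c d : ℚ} (hc : Constraint.varConst x .ge c ∈ C.constraints)
      (hd : Constraint.varConst x .le d ∈ C.constraints) : compress E (β x) = β x :=
    compress_eq_self ((abs_cast_le (hb.constraints _ hc).2.1).1.trans (h _ hc))
      (le_trans (h _ hd) (abs_cast_le (hb.constraints _ hd).2.1).2)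
  intro a ha
  have hβ := h a ha
  cases a with
  | varConst x r c =>
    have hc := abs_cast_le (hb.constraints _ ha).2.1
    rw [Constraint.Holds, ← compress_eq_self hc.1 hc.2]
    exact (Rel.holds_congr hm.lt_iff_lt hm.lt_iff_lt r).2 hβ
  | varVar x r y => exact (Rel.holds_congr hm.lt_iff_lt hm.lt_iff_lt r).2 hβ
  | diff x y r c =>
    obtain ⟨cx, dx, cy, dy, h1, h2, h3, h4⟩ := hC.bounded x y r c ha
    rw [Constraint.Holds, hfix h1 h2, hfix h3 h4]
    exact hβ

theorem Constraint.holds_congr_of_eq {E : ℕ} {a : Constraint} (ha : a.Below E) {β β' : ℕ → ℝ}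
    (h : ∀ x < E, β x = β' x) : a.Holds β ↔ a.Holds β' := by
  cases a with
  | varConst x r c => rw [Constraint.Holds, Constraint.Holds, h x ha.1]
  | varVar x r y => rw [Constraint.Holds, Constraint.Holds, h x ha.1, h y ha.2]
  | diff x y r c => rw [Constraint.Holds, Constraint.Holds, h x ha.1, h y ha.2.1]

/-! ### Ranks of fractional parts -/

/-- The rank of `F x` among the positive numbers `F 0, …, F (E - 1)`. -/
noncomputable def rank (E : ℕ) (F : ℕ → ℝ) (x : ℕ) : ℕ :=
  open Classical in ((Finset.range E).filter fun z => 0 < F z ∧ F z ≤ F x).card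

theorem rank_le (E : ℕ) (F : ℕ → ℝ) (x : ℕ) : rank E F x ≤ E :=
  (Finset.card_filter_le _ _).trans (Finset.card_range E).le

theorem rank_pos {E : ℕ} {F : ℕ → ℝ} {x : ℕ} (hx : x < E) : 0 < rank E F x ↔ 0 < F x := by
  rw [rank, Finset.card_pos]
  constructor
  · rintro ⟨z, hz⟩
    have := (Finset.mem_filter.1 hz).2
    linarith
  · intro h
    exact ⟨x, Finset.mem_filter.2 ⟨Finset.mem_range.2 hx, h, le_rfl⟩⟩

/-- If `F x < F y`, the index `y` itself is counted for `y` but not for `x`. -/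
theorem rank_lt {E : ℕ} {F : ℕ → ℝ} (hF : ∀ x, 0 ≤ F x) {x y : ℕ} (hy : y < E) :
    rank E F x < rank E F y ↔ F x < F y := by
  classical
  constructor
  · intro h
    by_contra! hle
    refine absurd h (not_lt.2 (Finset.card_le_card fun z hz => ?_))
    rw [Finset.mem_filter] at hz ⊢
    exact ⟨hz.1, hz.2.1, hz.2.2.trans hle⟩
  · intro h
    refine Finset.card_lt_card (Finset.ssubset_iff_subset_ne.2 ⟨fun z hz => ?_, fun he => ?_⟩)
    · rw [Finset.mem_filter] at hz ⊢
      exact ⟨hz.1, hz.2.1, hz.2.2.trans h.le⟩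
    · have hmem : y ∈ (Finset.range E).filter fun z => 0 < F z ∧ F z ≤ F y :=
        Finset.mem_filter.2 ⟨Finset.mem_range.2 hy, (hF x).trans_lt h, le_rfl⟩
      rw [← he, Finset.mem_filter] at hmem
      linarith [hmem.2.2]

/-! ### A finite model yields a model -/

/-- The shift by `E + 1` makes the value positive, so the natural-number floor is its true integer
part. -/
noncomputable def scaled (E : ℕ) (x : ℝ) : ℝ := E.factorial * (compress E x + (E + 1))

noncomputable def fracPart (E : ℕ) (x : ℝ) : ℝ := scaled E x - ⌊scaled E x⌋₊

theorem scaled_pos (E : ℕ) (x : ℝ) : 0 < scaled E x := by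
  have : (0 : ℝ) < E.factorial := by exact_mod_cast E.factorial_pos
  have := (compress_bounds E x).1
  exact mul_pos ‹_› (by linarith)

theorem floor_scaled_lt (E : ℕ) (x : ℝ) : ⌊scaled E x⌋₊ < 2 * (E + 1) * E.factorial := by
  have : (0 : ℝ) < E.factorial := by exact_mod_cast E.factorial_pos
  rw [Nat.floor_lt (scaled_pos E x).le, scaled]
  push_cast
  rw [mul_comm]
  gcongr
  linarith [(compress_bounds E x).2]

theorem fracPart_mem (E : ℕ) (x : ℝ) : 0 ≤ fracPart E x ∧ fracPart E x < 1 :=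
  ⟨sub_nonneg.2 (Nat.floor_le (scaled_pos E x).le), sub_lt_iff_lt_add'.2 (Nat.lt_floor_add_one _)⟩

theorem realPos_fracPart (E : ℕ) (x : ℝ) :
    realPos E ⌊scaled E x⌋₊ (fracPart E x) = compress E x := by
  have : (E.factorial : ℝ) ≠ 0 := by exact_mod_cast E.factorial_ne_zero
  rw [realPos, fracPart, add_sub_cancel, scaled]
  field_simp
  ring

noncomputable def groundValue (E : ℕ) (ρ : List ℕ) :
    ℝ ⊕ ULift.{u} {e : ℕ // e ∈ 0 :: ρ} → GVal ℝ
  | .inl x => (.inl ⌊scaled E x⌋₊, fracPart E x)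
  | .inr e => (.inr e.down.1, 0)

/-- The interpretation in which an atom is true if it is similar to one in `V`. -/
noncomputable def finiteInterpretation (E : ℕ) (ρ : List ℕ) (V : List (ℕ × List (GVal ℕ))) :
    Interpretation.{u} where
  S := ULift.{u} {e : ℕ // e ∈ 0 :: ρ}
  nonempty := ⟨⟨0, List.mem_cons_self⟩⟩
  const n := ⟨ρ.getD n 0, getD_mem_cons ρ n 0⟩
  rel P := {v | v.map valueSort = P.profile ∧
    ∃ w ∈ V, w.1 = encode P ∧ Sim w.2 (v.map (groundValue E ρ))}
  rel_sorted _ _ h := h.1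

/-- Each real assignment is replaced by the grid assignment of its region after compression. The
constraints pass to the grid, and atoms have the same truth value on both sides by similarity. -/
theorem satisfiable_of_finitelySatisfiable {E : ℕ} {N : ClauseSet} (hN : N.IsBSRBD)
    (hE : ∀ C ∈ N, C.Below E) (h : FinitelySatisfiable E N) : ClauseSet.Satisfiable.{u} N := by
  obtain ⟨ρ, -, V, -, hcheck⟩ := h
  refine ⟨finiteInterpretation E ρ V, fun C hC βR βS hΛ hΓ => ?_⟩
  have hCN := hN C hC
  have hCE := hE C hC
  set F : ℕ → ℝ := fun x => fracPart E (βR x) with hF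
  have hF0 (x : ℕ) : 0 ≤ F x ∧ F x < 1 := fracPart_mem E (βR x)
  -- The grid point of a variable has the floor as its cell and the rank of the fractional part as
  -- its remainder; ranks are at most `E`, hence valid remainders modulo `E + 1`.
  set b : List ℕ := (List.range E).map fun x => ⌊scaled E (βR x)⌋₊ * (E + 1) + rank E F x with hb
  set s : List ℕ := (List.range E).map fun n => (βS n).down.1 with hs
  have hpoint {x : ℕ} (hx : x < E) :
      pointVal E (b.getD x 0) = (.inl ⌊scaled E (βR x)⌋₊, rank E F x) := by
    have hr := rank_le E F x
    rw [hb, getD_map_range _ _ hx, pointVal, mul_comm, Nat.mul_add_div E.succ_pos,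
      Nat.div_eq_of_lt (by omega), Nat.mul_add_mod, Nat.mod_eq_of_lt (by omega), add_zero]
  have hbmem : b ∈ listsUpTo (List.range (numPoints E)) E := by
    refine mem_listsUpTo.2 ⟨by simp [hb], fun n hn => ?_⟩
    obtain ⟨x, -, rfl⟩ := List.mem_map.1 hn
    have h1 := floor_scaled_lt E (βR x)
    have h2 := rank_le E F x
    rw [List.mem_range, numPoints, denom]
    calc ⌊scaled E (βR x)⌋₊ * (E + 1) + rank E F x < (⌊scaled E (βR x)⌋₊ + 1) * (E + 1) := by
          rw [add_mul]; omega
      _ ≤ 2 * (E + 1) * E.factorial * (E + 1) := Nat.mul_le_mul_right _ h1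
      _ = _ := by ring
  have hsmem : s ∈ listsUpTo (0 :: ρ) E := by
    refine mem_listsUpTo.2 ⟨by simp [hs], fun n hn => ?_⟩
    obtain ⟨x, -, rfl⟩ := List.mem_map.1 hn
    exact (βS x).down.2
  have hterm {t : FreeTerm} (ht : t.Below E) :
      ((finiteInterpretation.{u} E ρ V).evalFree βS t).down.1 = t.value ρ s := by
    cases t with
    | var n => exact (getD_map_range (fun n => (βS n).down.1) 0 ht).symm
    | const n => rfl
  have hconstraint (a : Constraint) (ha : a ∈ C.constraints) : a.Check E b := by
    have hbelow := hCE.constraints a ha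
    rw [Constraint.check_iff_holds hbelow hF0]
    · refine (Constraint.holds_congr_of_eq hbelow fun x hx => ?_).1 (holds_compress hCN hCE hΛ a ha)
      have := congrArg Prod.fst (hpoint hx)
      rw [Sum.inl.inj this]
      exact (realPos_fracPart E (βR x)).symm
    · intro x hx
      rw [hpoint hx, rank_pos hx]
    · intro x hx y hy
      rw [hpoint hx, hpoint hy, rank_lt (fun x => (hF0 x).1) hy]
  have hatom {a : FreeAtom} (ha : a.Below E) (hw : a.WellSorted) :
      (finiteInterpretation.{u} E ρ V).HoldsAtom βR βS a ↔ a.Check E ρ V b s := by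
    cases a with
    | eqn t t' =>
      rw [Interpretation.HoldsAtom, FreeAtom.Check, ← hterm ha.1, ← hterm ha.2]
      exact ⟨fun h => by rw [h], fun h => ULift.ext _ _ (Subtype.ext h)⟩
    | pred P args =>
      let ev : Arg → ℝ ⊕ ULift.{u} {e : ℕ // e ∈ 0 :: ρ} :=
        (finiteInterpretation.{u} E ρ V).evalArg βR βS
      have hsort : (args.map ev).map valueSort = P.profile := by
        rw [← hw, List.map_map]
        refine List.map_congr_left fun x _ => ?_
        cases x <;> rfl
      have hsim : Sim ((args.map ev).map (groundValue E ρ)) (args.map (Arg.value E ρ b s)) := by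
        rw [List.map_map]
        have hval (x : Arg) (hx : x ∈ args) :
            (∃ z < E, groundValue E ρ (ev x) = (.inl ⌊scaled E (βR z)⌋₊, F z) ∧
              x.value E ρ b s = (.inl ⌊scaled E (βR z)⌋₊, rank E F z)) ∨
            ∃ e, groundValue E ρ (ev x) = (.inr e, 0) ∧ x.value E ρ b s = (.inr e, 0) := by
          have hxE := ha.2.2 x hx
          cases x with
          | base z => exact .inl ⟨z, hxE, rfl, hpoint hxE⟩
          | free t => exact .inr ⟨_, rfl, by rw [hterm hxE]; rfl⟩
        refine Sim.map (fun x hx => ?_) (fun x hx => ?_) (fun x hx => ?_) (fun x hx y hy => ?_)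
          (by simp)
        · rcases hval x hx with ⟨z, hz, e1, e2⟩ | ⟨e, e1, e2⟩ <;> simp [e1, e2]
        · rcases hval x hx with ⟨z, hz, e1, e2⟩ | ⟨e, e1, e2⟩
          · simp only [Function.comp, e1, e2, rank_pos hz]
          · simp [e1, e2]
        · rcases hval x hx with ⟨z, hz, e1, e2⟩ | ⟨e, e1, e2⟩ <;> simp [e1, e2, (hF0 _).1]
        · rcases hval x hx with ⟨z, hz, e1, e2⟩ | ⟨e, e1, e2⟩ <;>
            rcases hval y hy with ⟨z', hz', e1', e2'⟩ | ⟨e', e1', e2'⟩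
          · simp only [Function.comp, e1, e2, e1', e2', rank_lt (fun x => (hF0 x).1) hz']
          · simp [e1, e2, e1', e2', (hF0 _).1]
          · simp only [Function.comp, e1, e2, e1', e2', rank_pos hz']
          · simp [e1, e2, e1', e2']
      constructor
      · rintro ⟨-, w, hw, hwP, hws⟩
        exact ⟨w, hw, hwP, hws.trans hsim⟩
      · rintro ⟨w, hw, hwP, hws⟩
        exact ⟨hsort, w, hw, hwP, hws.trans hsim.symm⟩
  obtain ⟨a, ha, hca⟩ := hcheck C hC b hbmem s hsmem hconstraint fun a ha =>
    (hatom (hCE.antecedent a ha) (hCN.wellSorted_antecedent a ha)).1 (hΓ a ha)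
  exact ⟨a, ha, (hatom (hCE.succedent a ha) (hCN.wellSorted_succedent a ha)).2 hca⟩

/-! ### A model yields a finite model -/

/-- Any strictly increasing sequence in `(0, 1)` would serve. It turns increasing tuples of naturals
into increasing fractional parts, to which Ramsey's theorem applies. -/
noncomputable def tau (n : ℕ) : ℝ := 1 - 1 / (n + 2)

theorem tau_pos (n : ℕ) : 0 < tau n := by
  have : (0 : ℝ) ≤ n := n.cast_nonneg
  rw [tau, sub_pos, div_lt_one (by linarith)]
  linarith

theorem tau_lt_one (n : ℕ) : tau n < 1 :=
  sub_lt_self _ (by positivity)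

theorem tau_strictMono : StrictMono tau := by
  intro m n h
  have : (m : ℝ) < n := by exact_mod_cast h
  unfold tau
  gcongr

/-- The fractional part of rank `r` given by the sequence `p`; rank `0` stands for `0`. -/
noncomputable def frac (p : List ℕ) (r : ℕ) : ℝ := (0 :: p.map tau).getD r 0

theorem frac_zero (p : List ℕ) : frac p 0 = 0 := rfl

theorem frac_succ {p : List ℕ} {r : ℕ} (h : r < p.length) : frac p (r + 1) = tau p[r] := by
  simp [frac, h]

theorem frac_eq_zero {p : List ℕ} {r : ℕ} (h : p.length < r) : frac p r = 0 :=
  List.getD_eq_default _ _ (by simpa using h)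

theorem frac_mem (p : List ℕ) (r : ℕ) : 0 ≤ frac p r ∧ frac p r < 1 := by
  rcases lt_or_ge p.length r with h | h
  · rw [frac_eq_zero h]
    norm_num
  · cases r with
    | zero => rw [frac_zero]; norm_num
    | succ r => rw [frac_succ h]; exact ⟨(tau_pos _).le, tau_lt_one _⟩

theorem frac_lt_frac {p : List ℕ} (hp : p.Pairwise (· < ·)) {r r' : ℕ} (h : r < r')
    (h' : r' ≤ p.length) : frac p r < frac p r' := by
  obtain ⟨r', rfl⟩ := Nat.exists_eq_succ_of_ne_zero (Nat.ne_zero_of_lt h)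
  rw [Nat.succ_eq_add_one, frac_succ h']
  cases r with
  | zero => exact tau_pos _
  | succ r =>
    rw [frac_succ (by omega)]
    exact tau_strictMono (List.pairwise_iff_getElem.1 hp _ _ _ _ (by omega))

theorem frac_lt_frac_iff {p : List ℕ} (hp : p.Pairwise (· < ·)) {r r' : ℕ} (h : r ≤ p.length)
    (h' : r' ≤ p.length) : frac p r < frac p r' ↔ r < r' := by
  refine ⟨fun hlt => ?_, fun hlt => frac_lt_frac hp hlt h'⟩
  by_contra! hle
  rcases hle.lt_or_eq with hle | rfl
  · exact lt_asymm hlt (frac_lt_frac hp hle h)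
  · exact lt_irrefl _ hlt

/-! ### Similar lists as instances of a common pattern -/

noncomputable def relabel (p : List ℕ) (x : GVal ℕ) : GVal ℝ := (x.1, frac p x.2)

theorem map_getD_range' (g : List ℕ) :
    (List.range' 1 g.length).map (fun r => g.getD (r - 1) 0) = g := by
  refine List.ext_getElem (by simp) fun i h1 h2 => ?_
  simp [h2]

theorem frac_map_getD {g p : List ℕ} (hp : ∀ r ∈ p, 0 < r ∧ r ≤ g.length) (k : ℕ) :
    frac (p.map fun r => g.getD (r - 1) 0) k = frac g ((0 :: p).getD k 0) := by
  rcases lt_or_ge p.length k with h | h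
  · rw [frac_eq_zero (by simpa), List.getD_eq_default _ _ (by simpa), frac_zero]
  · cases k with
    | zero => rfl
    | succ k =>
      have hk : k < p.length := h
      obtain ⟨h1, h2⟩ := hp _ (List.getElem_mem hk)
      rw [frac_succ (by simpa)]
      have e : (0 :: p).getD (k + 1) 0 = (p[k] - 1) + 1 := by
        rw [List.getD_cons_succ, List.getD_eq_getElem _ _ hk]
        omega
      rw [e, frac_succ (by omega)]
      simp [show p[k] - 1 < g.length by omega]

theorem sublist_range'_of_pairwise {l : List ℕ} {n : ℕ} (hl : l.Pairwise (· < ·))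
    (h : ∀ r ∈ l, 0 < r ∧ r ≤ n) : l.Sublist (List.range' 1 n) := by
  have hsub : l.Subperm (List.range' 1 n) :=
    List.subperm_of_subset (hl.imp fun h => h.ne) fun r hr => by
      have := h r hr
      rw [List.mem_range'_1]
      omega
  exact List.sublist_of_subperm_of_pairwise hsub hl List.pairwise_lt_range'

/-- Similar lists of ground arguments are instances of one list at two subsequences of the same
length. -/
theorem Sim.exists_common_pattern {g : List ℕ} {a a' : List (GVal ℕ)} (h : Sim a a')
    (ha : ∀ x ∈ a, x.2 ≤ g.length) (ha' : ∀ x ∈ a', x.2 ≤ g.length) :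
    ∃ (k : ℕ → ℕ) (p p' : List ℕ), p.Sublist g ∧ p'.Sublist g ∧ p.length = p'.length ∧
      k 0 = 0 ∧ (∀ x ∈ a, k x.2 ≤ g.length) ∧
      (a.map fun x => (x.1, k x.2)).map (relabel p) = a.map (relabel g) ∧
      (a.map fun x => (x.1, k x.2)).map (relabel p') = a'.map (relabel g) := by
  set d : GVal ℕ := (.inl 0, 0) with hd
  have hlt (i j : ℕ) : (a.getD i d).2 < (a.getD j d).2 ↔ (a'.getD i d).2 < (a'.getD j d).2 :=
    (h.2 i).2 j
  have hle (i j : ℕ) : (a.getD i d).2 ≤ (a.getD j d).2 ↔ (a'.getD i d).2 ≤ (a'.getD j d).2 := by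
    rw [← not_lt, ← not_lt, hlt]
  have hpos (i : ℕ) : 0 < (a.getD i d).2 ↔ 0 < (a'.getD i d).2 := by
    -- The index just past the end reads the default 0 in both lists.
    have := hlt a.length i
    rwa [List.getD_eq_default _ _ le_rfl, List.getD_eq_default _ _ h.1.ge] at this
  set res := a.map Prod.snd with hres
  -- The map `f` sends a rank occurring in `a` to the rank at the same place in `a'`; by similarity
  -- it is well defined and increasing.
  set f : ℕ → ℕ := fun r => (a'.getD (res.idxOf r) d).2 with hf
  have hidx {r : ℕ} (hr : r ∈ res) : (a.getD (res.idxOf r) d).2 = r := by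
    have h1 := List.idxOf_lt_length_iff.2 hr
    have h2 : res.idxOf r < a.length := by simpa [hres] using h1
    have h3 := List.getElem_idxOf h1
    rw [List.getD_eq_getElem _ _ h2]
    exact (List.getElem_map Prod.snd (h := h1)).symm.trans h3
  have hmono {r r' : ℕ} (hr : r ∈ res) (hr' : r' ∈ res) (hlt' : r < r') : f r < f r' := by
    rw [hf]
    simp only
    rwa [← hlt, hidx hr, hidx hr']
  have hfval {i : ℕ} (hi : i < a.length) : f (a.getD i d).2 = (a'.getD i d).2 := by
    have hmem : (a.getD i d).2 ∈ res := by
      rw [List.getD_eq_getElem _ _ hi]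
      exact List.mem_map_of_mem (List.getElem_mem hi)
    exact le_antisymm ((hle _ _).1 (hidx hmem).le) ((hle _ _).1 (hidx hmem).ge)
  have hf0 : f 0 = 0 := by
    have : ¬ 0 < (a.getD (res.idxOf 0) d).2 := by
      by_cases h0 : 0 ∈ res
      · rw [hidx h0]
        exact lt_irrefl _
      -- If 0 does not occur, `idxOf` returns the length and the lookup falls back to 0.
      · rw [List.getD_eq_default]
        · exact lt_irrefl _
        · rw [List.idxOf_eq_length_iff.2 h0]
          simp [hres]
    rw [hpos] at this
    exact Nat.eq_zero_of_not_pos this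
  set q := (List.range' 1 g.length).filter (· ∈ res) with hq
  have hqmem {r : ℕ} : r ∈ q ↔ (0 < r ∧ r ≤ g.length) ∧ r ∈ res := by
    rw [hq, List.mem_filter, List.mem_range'_1]
    simp only [decide_eq_true_eq]
    refine and_congr_left fun _ => ?_
    omega
  have hqsort : q.Pairwise (· < ·) := List.Pairwise.filter _ List.pairwise_lt_range'
  have hfq : ∀ r ∈ q.map f, 0 < r ∧ r ≤ g.length := by
    intro r' hr'
    obtain ⟨r, hr, rfl⟩ := List.mem_map.1 hr'
    obtain ⟨⟨h1, -⟩, h2⟩ := hqmem.1 hr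
    have h3 : res.idxOf r < a'.length := by
      simpa [hres, h.1] using List.idxOf_lt_length_iff.2 h2
    refine ⟨(hpos _).1 (by rwa [hidx h2]), ?_⟩
    rw [hf]
    simp only
    rw [List.getD_eq_getElem _ _ h3]
    exact ha' _ (List.getElem_mem h3)
  have hfsort : (q.map f).Pairwise (· < ·) :=
    List.pairwise_map.2 (hqsort.imp_of_mem fun h1 h2 h =>
      hmono (hqmem.1 h1).2 (hqmem.1 h2).2 h)
  have hsub {l : List ℕ} (hl : l.Sublist (List.range' 1 g.length)) :
      (l.map fun r => g.getD (r - 1) 0).Sublist g := by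
    have := hl.map fun r => g.getD (r - 1) 0
    rwa [map_getD_range'] at this
  have hmemq {x : GVal ℕ} (hx : x ∈ a) : x.2 ∈ 0 :: q := by
    rcases Nat.eq_zero_or_pos x.2 with h0 | h0
    · rw [h0]; exact List.mem_cons_self
    · exact List.mem_cons_of_mem _ (hqmem.2 ⟨⟨h0, ha x hx⟩, List.mem_map_of_mem hx⟩)
  have hget {x : GVal ℕ} (hx : x ∈ a) : (0 :: q).getD ((0 :: q).idxOf x.2) 0 = x.2 := by
    have h1 := List.idxOf_lt_length_iff.2 (hmemq hx)
    rw [List.getD_eq_getElem _ _ h1, List.getElem_idxOf h1]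
  -- The pattern renumbers the positive ranks of `a` consecutively. Rank `r` sits at position `r -
  -- 1` of `g`, so `p` picks the terms of `g` used by `a` and `p'` those used by `a'`.
  refine ⟨fun r => (0 :: q).idxOf r, q.map fun r => g.getD (r - 1) 0,
    (q.map f).map fun r => g.getD (r - 1) 0, hsub List.filter_sublist,
    hsub (sublist_range'_of_pairwise hfsort hfq), by simp, by simp, fun x hx => ?_, ?_, ?_⟩
  · have h1 := List.idxOf_lt_length_iff.2 (hmemq hx)
    have h2 : q.length ≤ g.length := by
      simpa using (List.filter_sublist (l := List.range' 1 g.length) (p := (· ∈ res))).length_le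
    simp only [List.length_cons] at h1
    change (0 :: q).idxOf x.2 ≤ g.length
    omega
  · rw [List.map_map]
    refine List.map_congr_left fun x hx => ?_
    simp only [Function.comp, relabel]
    rw [frac_map_getD fun r hr => (hqmem.1 hr).1, hget hx]
  · refine List.ext_getElem (by simpa using h.1) fun i h1 h2 => ?_
    have hi : i < a.length := by simpa using h1
    have hi' : i < a'.length := by simpa using h2
    have hl := (h.2 i).1
    have hr := hfval hi
    rw [List.getD_eq_getElem _ _ hi, List.getD_eq_getElem _ _ hi'] at hl hr
    simp only [List.getElem_map, relabel]
    rw [frac_map_getD hfq, hl]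
    have e : (0 :: q.map f).getD ((0 :: q).idxOf a[i].2) 0 =
        f ((0 :: q).getD ((0 :: q).idxOf a[i].2) 0) := by
      have := List.getD_map (0 :: q) 0 (n := (0 :: q).idxOf a[i].2) f
      rwa [List.map_cons, hf0] at this
    rw [e, hget (List.getElem_mem hi), hr]

/-! ### Coded atoms evaluated in an interpretation -/

noncomputable def realize (A : Interpretation.{u}) (E : ℕ) : GVal ℝ → ℝ ⊕ A.S
  | (.inl q, f) => .inl (realPos E q f)
  | (.inr e, _) => .inr (A.const e)

/-- The truth value of a coded atom in `A` at the fractional parts given by `p`. -/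
def TrueAt (A : Interpretation.{u}) (E : ℕ) (w : ℕ × List (GVal ℕ)) (p : List ℕ) : Prop :=
  ∃ P, encode P = w.1 ∧ (w.2.map (relabel p)).map (realize A E) ∈ A.rel P

theorem mem_groundValues_snd_le {E : ℕ} {x : GVal ℕ} (h : x ∈ groundValues E) : x.2 ≤ E := by
  obtain ⟨q | e, r⟩ := x
  · exact (inl_mem_groundValues.1 h).2
  · exact (inr_mem_groundValues.1 h).2.trans_le E.zero_le

/-- Similar atoms are one pattern evaluated at two subsequences of `g` of equal length, so
homogeneity for that pattern makes their truth values agree. -/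
theorem exists_trueAt_iff_of_sim (A : Interpretation.{u}) (E : ℕ) :
    ∃ g : List ℕ, g.length = E ∧ g.Pairwise (· < ·) ∧
      ∀ c a a', (c, a) ∈ groundAtoms E → (c, a') ∈ groundAtoms E → Sim a a' →
        (TrueAt A E (c, a) g ↔ TrueAt A E (c, a') g) := by
  have : Finite {w // w ∈ groundAtoms E} := (List.finite_toSet (groundAtoms E)).to_subtype
  obtain ⟨g, hlen, hsort, hg⟩ :=
    exists_homogeneous (fun (w : {w // w ∈ groundAtoms E}) p => TrueAt A E w.1 p) E
  refine ⟨g, hlen, hsort, fun c a a' ha ha' hsim => ?_⟩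
  obtain ⟨hc, hal, hav⟩ := mem_groundAtoms.1 ha
  have hav' := (mem_groundAtoms.1 ha').2.2
  obtain ⟨k, p, p', hp, hp', hpp, hk0, hk, e, e'⟩ := hsim.exists_common_pattern (g := g)
    (fun x hx => hlen ▸ mem_groundValues_snd_le (hav x hx))
    (fun x hx => hlen ▸ mem_groundValues_snd_le (hav' x hx))
  -- The pattern must itself be one of the finitely many atoms for which `g` is homogeneous.
  have hmem : (c, a.map fun x => (x.1, k x.2)) ∈ groundAtoms E := by
    refine mem_groundAtoms.2 ⟨hc, by simpa, fun y hy => ?_⟩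
    obtain ⟨x, hx, rfl⟩ := List.mem_map.1 hy
    have hxv := hav x hx
    have hkx := hk x hx
    obtain ⟨q | e, r⟩ := x
    · exact inl_mem_groundValues.2 ⟨(inl_mem_groundValues.1 hxv).1, hlen ▸ hkx⟩
    · have := inr_mem_groundValues.1 hxv
      exact inr_mem_groundValues.2 ⟨this.1, by simp only [this.2, hk0]⟩
  have := hg ⟨_, hmem⟩ p p' hp hp' hpp
  simpa only [TrueAt, e, e'] using this

open Classical in
/-- The least index of a constant symbol with the same interpretation as the `n`-th one. -/
noncomputable def leastConst (A : Interpretation.{u}) (n : ℕ) : ℕ :=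
  Nat.find (⟨n, rfl⟩ : ∃ i, A.const i = A.const n)

theorem const_leastConst (A : Interpretation.{u}) (n : ℕ) :
    A.const (leastConst A n) = A.const n := by
  classical exact Nat.find_spec (⟨n, rfl⟩ : ∃ i, A.const i = A.const n)

theorem leastConst_le_of_eq {A : Interpretation.{u}} {i n : ℕ} (h : A.const i = A.const n) :
    leastConst A n ≤ i := by
  classical exact Nat.find_min' _ h

theorem leastConst_le (A : Interpretation.{u}) (n : ℕ) : leastConst A n ≤ n :=
  leastConst_le_of_eq rfl

theorem leastConst_congr {A : Interpretation.{u}} {m n : ℕ} (h : A.const m = A.const n) :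
    leastConst A m = leastConst A n :=
  le_antisymm (leastConst_le_of_eq ((const_leastConst A n).trans h.symm))
    (leastConst_le_of_eq ((const_leastConst A m).trans h))

/-- Each grid assignment becomes a real assignment in `A` by using `g` for the fractional parts. An
atom similar to a recorded true one is itself true by the choice of `g`, so the finite check agrees
with `A`. -/
theorem finitelySatisfiable_of_satisfiable {E : ℕ} {N : ClauseSet}
    (hE : ∀ C ∈ N, C.Below E) (h : ClauseSet.Satisfiable.{u} N) : FinitelySatisfiable E N := by
  classical
  obtain ⟨A, hA⟩ := h
  obtain ⟨g, hlen, hsort, hg⟩ := exists_trueAt_iff_of_sim A E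
  -- Canonical representatives make equality of numbers coincide with equality of the named elements
  -- of `A`.
  set ρ := (List.range E).map (leastConst A) with hρ
  set V := (groundAtoms E).filter fun w => TrueAt A E w g with hV
  refine ⟨ρ, mem_listsUpTo.2 ⟨by simp [hρ], fun e he => ?_⟩, V,
    mem_listsUpTo.2 ⟨List.length_filter_le _ _, fun w hw => (List.mem_filter.1 hw).1⟩, ?_⟩
  · obtain ⟨n, hn, rfl⟩ := List.mem_map.1 he
    exact List.mem_range.2 ((leastConst_le A n).trans_lt (List.mem_range.1 hn))
  intro C hC b hb s hs hΛ hΓ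
  have hCE := hE C hC
  obtain ⟨-, hb⟩ := mem_listsUpTo.1 hb
  obtain ⟨-, hs⟩ := mem_listsUpTo.1 hs
  have hfix {e : ℕ} (he : e ∈ 0 :: ρ) : leastConst A e = e := by
    rcases List.mem_cons.1 he with rfl | he
    · exact Nat.le_zero.1 (leastConst_le A 0)
    · obtain ⟨n, -, rfl⟩ := List.mem_map.1 he
      exact leastConst_congr (const_leastConst A n)
  have hinj {e e' : ℕ} (he : e ∈ 0 :: ρ) (he' : e' ∈ 0 :: ρ) (h : A.const e = A.const e') :
      e = e' := by
    rw [← hfix he, ← hfix he', leastConst_congr h]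
  set βR : ℕ → ℝ := fun x => realPos E (b.getD x 0 / (E + 1)) (frac g (b.getD x 0 % (E + 1)))
    with hβR
  set βS : ℕ → A.S := fun n => A.const (s.getD n 0) with hβS
  have hmod (n : ℕ) : n % (E + 1) ≤ g.length := by
    rw [hlen]
    exact Nat.lt_succ_iff.1 (Nat.mod_lt _ E.succ_pos)
  have hterm {t : FreeTerm} (ht : t.Below E) :
      t.value ρ s ∈ 0 :: ρ ∧ A.evalFree βS t = A.const (t.value ρ s) := by
    cases t with
    | var n =>
      refine ⟨?_, rfl⟩
      rcases List.mem_cons.1 (getD_mem_cons s n 0) with h | h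
      · exact List.mem_cons.2 (.inl h)
      · exact hs _ h
    | const n =>
      refine ⟨getD_mem_cons ρ n 0, ?_⟩
      rw [FreeTerm.value, hρ, getD_map_range _ _ ht, const_leastConst]
      rfl
  have hlt_of_mem {e : ℕ} (hE0 : 0 < E) (he : e ∈ 0 :: ρ) : e < E := by
    rcases List.mem_cons.1 he with rfl | he
    · exact hE0
    · obtain ⟨n, hn, rfl⟩ := List.mem_map.1 he
      exact (leastConst_le A n).trans_lt (List.mem_range.1 hn)
  have hatom {a : FreeAtom} (ha : a.Below E) :
      A.HoldsAtom βR βS a ↔ a.Check E ρ V b s := by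
    cases a with
    | eqn t t' =>
      obtain ⟨h1, h2⟩ := hterm ha.1
      obtain ⟨h3, h4⟩ := hterm ha.2
      rw [Interpretation.HoldsAtom, FreeAtom.Check, h2, h4]
      exact ⟨hinj h1 h3, fun h => by rw [h]⟩
    | pred P args =>
      have hE0 : 0 < E := (Nat.zero_le _).trans_lt ha.1
      set w := args.map (Arg.value E ρ b s) with hw
      have hmem : (encode P, w) ∈ groundAtoms E := by
        refine mem_groundAtoms.2 ⟨ha.1, by simpa [hw] using ha.2.1.le, fun v hv => ?_⟩
        obtain ⟨x, hx, rfl⟩ := List.mem_map.1 hv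
        have hxE := ha.2.2 x hx
        cases x with
        | base z =>
          refine List.mem_append_left _ (List.mem_map_of_mem (List.mem_range.2 ?_))
          rcases List.mem_cons.1 (getD_mem_cons b z 0) with h | h
          · rw [h]
            exact Nat.mul_pos (by omega) (denom_pos E)
          · exact List.mem_range.1 (hb _ h)
        | free t => exact inr_mem_groundValues.2 ⟨hlt_of_mem hE0 (hterm hxE).1, rfl⟩
      have heval : (w.map (relabel g)).map (realize A E) = args.map (A.evalArg βR βS) := by
        rw [hw, List.map_map, List.map_map]
        refine List.map_congr_left fun x hx => ?_
        have hxE := ha.2.2 x hx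
        cases x with
        | base z => rfl
        | free t => exact congrArg Sum.inr (hterm hxE).2.symm
      have htrue : TrueAt A E (encode P, w) g ↔ args.map (A.evalArg βR βS) ∈ A.rel P := by
        rw [← heval]
        constructor
        · rintro ⟨P', hP', h⟩
          rwa [encode_injective hP'] at h
        · exact fun h => ⟨P, rfl, h⟩
      rw [Interpretation.HoldsAtom, ← htrue]
      constructor
      · exact fun h => ⟨_, List.mem_filter.2 ⟨hmem, by simpa using h⟩, rfl, Sim.refl _⟩
      · rintro ⟨⟨c, v⟩, hv, rfl, hsim⟩
        obtain ⟨hv, hvt⟩ := List.mem_filter.1 hv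
        exact (hg _ _ _ hv hmem hsim).1 (by simpa using hvt)
  have hfrac_pos (x : ℕ) :
      0 < frac g (b.getD x 0 % (E + 1)) ↔ 0 < (pointVal E (b.getD x 0)).2 := by
    rw [← frac_zero g, frac_lt_frac_iff hsort (Nat.zero_le _) (hmod _)]
    rfl
  obtain ⟨a, ha, hca⟩ := hA C hC βR βS
    (fun a ha => (Constraint.check_iff_holds (hCE.constraints a ha) (fun x => frac_mem g _)
      (fun x _ => hfrac_pos x)
      (fun x _ y _ => frac_lt_frac_iff hsort (hmod _) (hmod _))).1 (hΛ a ha))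
    (fun a ha => (hatom (hCE.antecedent a ha)).2 (hΓ a ha))
  exact ⟨a, ha, (hatom (hCE.succedent a ha)).1 hca⟩

theorem satisfiable_iff {N : ClauseSet} (hN : N.IsBSRBD) :
    ClauseSet.Satisfiable.{u} N ↔ FinitelySatisfiable (encode N + 1) N :=
  ⟨finitelySatisfiable_of_satisfiable fun _ => ClauseSet.below,
    satisfiable_of_finitelySatisfiable hN fun _ => ClauseSet.below⟩

end BSRBD

/-- Satisfiability of finite BSR(BD) clause sets is decidable. -/
theorem theorem2 :
    ComputablePred fun N : BSRBD.ClauseSet => N.IsBSRBD ∧ BSRBD.ClauseSet.Satisfiable.{u} N := by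
  obtain ⟨hdec, h⟩ := BSRBD.primrecPred_isBSRBD.and
    (BSRBD.primrecPred_finitelySatisfiable (Primrec.succ.comp Primrec.encode) Primrec.id)
  -- The search criterion is correct for BSR(BD) sets, so the equivalence is taken under the
  -- syntactic condition.
  have hiff (N : BSRBD.ClauseSet) := and_congr_right (BSRBD.satisfiable_iff.{u} (N := N))
  exact ComputablePred.of_eq ⟨hdec, h.to_comp⟩ fun N => (hiff N).symm
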